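/- Let $n\ge 2$. For $\lambda>1$, a domain (non-empty connected open set) $\Omega\subseteq\mathbb{R}^n$ and a real function $u\in C^4(\Omega)$, not identically zero, with $\Delta^2u=\lambda^2u$ in $\Omega$, put $v=\Delta u-\lambda u$ and, for $y=(x,x_{n+1})\in\Omega\times\mathbb{R}$, $$g(y)=u(x)e^{\sqrt{\lambda}\,x_{n+1}},\qquad h(y)=v(x)e^{\sqrt{\lambda}\,x_{n+1}} .$$ For a ball with $\overline{B_r(y_0)}\subseteq\Omega\times\mathbb{R}$, $r>0$, define the frequency $$N(y_0,r)=r\,\frac{\int_{B_r(y_0)}\left(|\nabla g|^2+|\nabla h|^2+gh+2\lambda g^2\right)dy}{\int_{\partial B_r(y_0)}\left(g^2+h^2\right)d\sigma},$$ where $\sigma$ is the surface measure ($n$-dimensional Hausdorff measure) of $\partial B_r(y_0)\subset\mathbb{R}^{n+1}$. There are positive constants $C_0$, $K$, $C$, $C'$ depending only on $n$ such that, for all $\lambda$, $\Omega$, $u$ as above: 1. (the property that defines $C_0$) if $0<r\le1$, $\overline{B_r(y_0)}\subseteq\Omega\times\mathbb{R}$ and $N(y_0,r)\ge C_0$, then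 $\rho\mapsto\ln N(y_0,\rho)$ is differentiable at $r$ and its derivative there is at least $-K$; 2. if $0<r_1<r_2\le1$ and $\overline{B_{r_2}(0)}\subseteq\Omega\times\mathbb{R}$, then $$N(0,r_1)\le C\max\{C_0,N(0,r_2)\},$$ and if moreover $N(0,r)>C_0$ for all $r\in(r_1,r_2)$, then $$N(0,r_2)\ge C'N(0,r_1).$$ -/

import Mathlib

open Metric Set MeasureTheory InnerProductSpace

noncomputable section

namespace BiharmonicFrequency

/-- Euclidean space `ℝⁿ`. -/
abbrev E (n : ℕ) : Type := EuclideanSpace ℝ (Fin n)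

/-- `u` is a (nontrivial, classical) solution of `Δ²u = lam² u` in the domain `Ω ⊆ ℝⁿ`. -/
structure IsEigenfunction {n : ℕ} (lam : ℝ) (Ω : Set (E n)) (u : E n → ℝ) : Prop where
  isOpen : IsOpen Ω
  isConnected : IsConnected Ω
  contDiffOn : ContDiffOn ℝ 4 u Ω
  equation : ∀ x ∈ Ω, Laplacian.laplacian (Laplacian.laplacian u) x = lam ^ 2 * u x
  nontrivial : ∃ x ∈ Ω, u x ≠ 0

/-- The component `x ∈ ℝⁿ` of `y = (x, x_{n+1}) ∈ ℝⁿ⁺¹`. -/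
def proj {n : ℕ} (y : E (n + 1)) : E n := WithLp.toLp 2 fun i : Fin n => y i.castSucc

/-- The cylinder `Ω × ℝ ⊆ ℝⁿ⁺¹`. -/
def cylinder {n : ℕ} (Ω : Set (E n)) : Set (E (n + 1)) := {y | proj y ∈ Ω}

/-- `v = (Δ - lam) u`. -/
def vFun {n : ℕ} (lam : ℝ) (u : E n → ℝ) (x : E n) : ℝ :=
  Laplacian.laplacian u x - lam * u x

/-- `w(x) e^{√lam x_{n+1}}` as a function of `y = (x, x_{n+1})`. -/
def lift {n : ℕ} (lam : ℝ) (w : E n → ℝ) (y : E (n + 1)) : ℝ :=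
  w (proj y) * Real.exp (Real.sqrt lam * y (Fin.last n))

/-- `g(x, x_{n+1}) = u(x) e^{√lam x_{n+1}}`. -/
def gFun {n : ℕ} (lam : ℝ) (u : E n → ℝ) : E (n + 1) → ℝ := lift lam u

/-- `h(x, x_{n+1}) = v(x) e^{√lam x_{n+1}}`. -/
def hFun {n : ℕ} (lam : ℝ) (u : E n → ℝ) : E (n + 1) → ℝ := lift lam (vFun lam u)

/-- The surface integral `∫_{∂B_r(y₀)} f dσ` over the sphere of radius `r > 0` in `ℝⁿ⁺¹`, computed
on the unit sphere by `y = y₀ + r ω`, `dσ(y) = rⁿ dσ(ω)`. Here `volume.toSphere` is the surface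
measure of the unit sphere (the normalized `n`-dimensional Hausdorff measure on it). -/
def sphereIntegral {n : ℕ} (f : E (n + 1) → ℝ) (y₀ : E (n + 1)) (r : ℝ) : ℝ :=
  r ^ n * ∫ ω : sphere (0 : E (n + 1)) 1, f (y₀ + r • (ω : E (n + 1)))
    ∂(volume : Measure (E (n + 1))).toSphere

/-- `D(y₀,r) = ∫_{B_r(y₀)} (|∇g|² + |∇h|² + g h + 2 lam g²) dy`. -/
def D {n : ℕ} (lam : ℝ) (u : E n → ℝ) (y₀ : E (n + 1)) (r : ℝ) : ℝ :=
  ∫ y in ball y₀ r, (‖gradient (gFun lam u) y‖ ^ 2 + ‖gradient (hFun lam u) y‖ ^ 2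
    + gFun lam u y * hFun lam u y + 2 * lam * gFun lam u y ^ 2)

/-- `H(y₀,r) = ∫_{∂B_r(y₀)} (g² + h²) dσ`. -/
def H {n : ℕ} (lam : ℝ) (u : E n → ℝ) (y₀ : E (n + 1)) (r : ℝ) : ℝ :=
  sphereIntegral (fun y => gFun lam u y ^ 2 + hFun lam u y ^ 2) y₀ r

/-- The frequency function `N(y₀,r) = r D(y₀,r) / H(y₀,r)`. -/
def N {n : ℕ} (lam : ℝ) (u : E n → ℝ) (y₀ : E (n + 1)) (r : ℝ) : ℝ :=
  r * (D lam u y₀ r / H lam u y₀ r)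

/-- The monotonicity formula in dimension `n` with threshold `C₀` and constant `K`: whenever
`N(y₀,r) ≥ C₀` and `r ≤ 1`, the function `ln N(y₀,·)` is differentiable at `r` with
derivative at least `-K`. -/
def MonotonicityFormula (n : ℕ) (C₀ K : ℝ) : Prop :=
  ∀ (lam : ℝ), 1 < lam → ∀ (Ω : Set (E n)) (u : E n → ℝ), IsEigenfunction lam Ω u →
    ∀ (y₀ : E (n + 1)) (r : ℝ), 0 < r → r ≤ 1 → closedBall y₀ r ⊆ cylinder Ω →
      C₀ ≤ N lam u y₀ r →
        DifferentiableAt ℝ (fun ρ => Real.log (N lam u y₀ ρ)) r ∧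
          -K ≤ deriv (fun ρ => Real.log (N lam u y₀ ρ)) r

end BiharmonicFrequency

end

/-!
# Almost monotonicity of the frequency of a bi-Laplacian eigenfunction

The lifts `g` and `h` satisfy `Δg = 2 lam g + h` and `Δh = 0` in the cylinder, so that the energy
`D` is the integral of `div (g ∇g + h ∇h)` and `r D(r) = ∫_{∂B_r} (g ∂ρg + h ∂ρh)`, where
`∂ρ = (y - y₀) · ∇` (`IsCoupledPair.mul_energy`). Hence `H' = n H / r + 2 D`. Rellich's identity
computes `D'` (`IsCoupledPair.sq_mul_sphereIntegral_energyDensity`), and the Cauchy-Schwarz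
inequality on the sphere leaves
`(ln N)' ≥ M / (r D)` with
`M = 4 lam ∫ g² - (n - 1) ∫ g h - 2 ∫ (∂ρg) h + r ∫_{∂B_r} g h`,
the first three integrals being over `B_r`. If `N ≥ 1`, then `H ≤ r D`. As `h` is harmonic,
`∫_{B_r} h² ≤ r H`, and since `lam > 1` the energy controls `∫ (|∇g|² + g²)` up to `∫ h²`. So every
term of `M` that can be negative is `O(r D)` with a constant depending only on `n`, and
`(ln N)' ≥ -(2 n + 2)` (`IsCoupledPair.hasDerivAt_log_frequency`). The threshold is `C₀ = 1`.

The comparison of two radii `r₁ < r₂` integrates this bound. If `N(r₁) ≤ 1` the upper bound is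
trivial; otherwise one integrates from `r₁` to the first radius at which `N` falls to `1`, or to
`r₂`. No unique continuation is needed: if `H` vanishes at some radius, then `g = h = 0` in the
ball, and `H` vanishes at all smaller radii (`IsCoupledPair.height_eq_zero_of_lt`). So `H` is
nonzero, and `N` continuous, beyond any radius at which `N > 1`.

The divergence theorem on balls (`mul_integral_ball_partialDeriv`) is obtained from integration by
parts against the `C¹` function `(max (r² - |y - y₀|²) 0)²`. In polar coordinates the derivative in
`r` of an integral over `B_r` is the integral over `∂B_r`; differentiating the resulting identity
twice in `r` removes the weight and produces the boundary term.

Everything is local to a ball whose closure lies in the cylinder, so `g` and `h` are multiplied by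
a bump function (`IsEigenfunction.exists_isCoupledPair`), and the analysis is done for globally
defined `C²` functions that satisfy the equations only on a ball.
-/

namespace BiharmonicFrequency

/-! ### Integration in polar coordinates -/

/-- Polar coordinates in `ℝⁿ⁺¹`. -/
lemma integral_eq_integral_Ioi_sphere {n : ℕ} {f : E (n + 1) → ℝ} (hf : Integrable f) :
    ∫ y, f y = ∫ s in Ioi (0 : ℝ), sphereIntegral f 0 s := by
  have hmp := (volume : Measure (E (n + 1))).measurePreserving_homeomorphUnitSphereProd
  have hemb := (homeomorphUnitSphereProd (E (n + 1))).measurableEmbedding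
  set e := homeomorphUnitSphereProd (E (n + 1)) with he
  have hdim : Module.finrank ℝ (E (n + 1)) - 1 = n := by simp [E]
  rw [hdim] at hmp
  let G : sphere (0 : E (n + 1)) 1 × Ioi (0 : ℝ) → ℝ := fun p => f (p.2.1 • p.1.1)
  have hG : ∀ x : ({0}ᶜ : Set (E (n + 1))), G (e x) = f x := by
    intro x
    simp [G, he, smul_smul, norm_ne_zero_iff.2 (show (x : E (n + 1)) ≠ 0 from x.2)]
  have h1 : ∫ y, f y = ∫ x : ({0}ᶜ : Set (E (n + 1))), f x ∂(Measure.comap Subtype.val volume) := by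
    rw [integral_subtype_comap (measurableSet_singleton _).compl fun x ↦ f x,
        restrict_compl_singleton]
  have h2 : ∫ x : ({0}ᶜ : Set (E (n + 1))), f x ∂(Measure.comap Subtype.val volume)
      = ∫ p, G p ∂((volume : Measure (E (n + 1))).toSphere.prod (.volumeIoiPow n)) := by
    rw [← hmp.integral_comp hemb G]
    simp only [hG]
  have hGi : Integrable G ((volume : Measure (E (n + 1))).toSphere.prod (.volumeIoiPow n)) := by
    rw [← hmp.integrable_comp_emb hemb]
    have : G ∘ e = f ∘ Subtype.val := funext hG
    rw [this]
    have h3 := (integrableOn_iff_comap_subtypeVal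
      (measurableSet_singleton (0 : E (n + 1))).compl (μ := volume) (f := f)).1 hf.integrableOn
    exact h3
  rw [h1, h2, integral_prod_symm _ hGi]
  simp only [Measure.volumeIoiPow, ENNReal.ofReal]
  rw [integral_withDensity_eq_integral_smul,
    integral_subtype_comap measurableSet_Ioi fun a ↦ Real.toNNReal (a ^ n) •
      ∫ ω : sphere (0 : E (n + 1)) 1, f (a • ω.1) ∂(volume : Measure (E (n + 1))).toSphere,
    setIntegral_congr_fun measurableSet_Ioi fun x hx ↦ ?_]
  · simp only [sphereIntegral, zero_add]
    rw [NNReal.smul_def, Real.coe_toNNReal _ (pow_nonneg (mem_Ioi.1 hx).le _), smul_eq_mul]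
  · exact (measurable_subtype_coe.pow_const _).real_toNNReal

lemma integrable_sphere {n : ℕ} {f : E (n + 1) → ℝ} (hf : Continuous f) (y₀ : E (n + 1)) (r : ℝ) :
    Integrable (fun ω : sphere (0 : E (n + 1)) 1 => f (y₀ + r • (ω : E (n + 1))))
      (volume : Measure (E (n + 1))).toSphere := by
  have : Continuous (fun ω : sphere (0 : E (n + 1)) 1 => f (y₀ + r • (ω : E (n + 1)))) := by
    fun_prop
  exact this.integrable_of_hasCompactSupport (HasCompactSupport.of_compactSpace _)

lemma continuous_sphereIntegral {n : ℕ} {f : E (n + 1) → ℝ} (hf : Continuous f)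
    (y₀ : E (n + 1)) : Continuous (sphereIntegral f y₀) := by
  unfold sphereIntegral
  refine (continuous_pow n).mul ?_
  have := continuous_parametric_integral_of_continuous
    (μ := (volume : Measure (E (n + 1))).toSphere) (s := univ)
    (f := fun (r : ℝ) (ω : sphere (0 : E (n + 1)) 1) => f (y₀ + r • (ω : E (n + 1))))
    (by simp only [Function.uncurry_def]; fun_prop) isCompact_univ
  simpa using this

lemma integrableOn_ball {n : ℕ} {f : E (n + 1) → ℝ} (hf : Continuous f) (y₀ : E (n + 1)) (r : ℝ) :
    IntegrableOn f (ball y₀ r) :=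
  (hf.continuousOn.integrableOn_compact (isCompact_closedBall y₀ r)).mono_set ball_subset_closedBall

lemma integral_ball_eq_integral_sphereIntegral {n : ℕ} {f : E (n + 1) → ℝ} (hf : Continuous f)
    (y₀ : E (n + 1)) {r : ℝ} (hr : 0 ≤ r) :
    ∫ y in ball y₀ r, f y = ∫ s in (0 : ℝ)..r, sphereIntegral f y₀ s := by
  have hint : Integrable ((ball y₀ r).indicator f) :=
    (integrable_indicator_iff measurableSet_ball).2 (integrableOn_ball hf y₀ r)
  rw [← integral_indicator measurableSet_ball, ← integral_add_left_eq_self _ y₀,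
    integral_eq_integral_Ioi_sphere (hint.comp_add_left y₀), intervalIntegral.integral_of_le hr,
    integral_Ioc_eq_integral_Ioo, ← integral_indicator measurableSet_Ioi,
    ← integral_indicator measurableSet_Ioo]
  congr 1
  ext s
  by_cases hs : 0 < s
  · by_cases hsr : s < r
    · have : s ∈ Ioo 0 r := ⟨hs, hsr⟩
      rw [indicator_of_mem (mem_Ioi.2 hs), indicator_of_mem this]
      unfold sphereIntegral
      congr 2
      ext ω
      have hω : ‖(ω : E (n + 1))‖ = 1 := by simp
      dsimp only
      rw [indicator_of_mem]
      · simp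
      · simp [norm_smul, abs_of_pos hs, hsr]
    · have : s ∉ Ioo 0 r := fun h => hsr h.2
      rw [indicator_of_mem (mem_Ioi.2 hs), indicator_of_notMem this]
      unfold sphereIntegral
      refine mul_eq_zero_of_right _ (integral_eq_zero_of_ae (.of_forall fun ω => ?_))
      dsimp only
      rw [indicator_of_notMem]
      · rfl
      simp only [mem_ball, zero_add, dist_self_add_left, norm_smul, norm_eq_of_mem_sphere, mul_one,
        Real.norm_eq_abs, abs_of_pos hs]
      exact hsr
  · rw [indicator_of_notMem (s := Ioi 0) hs, indicator_of_notMem (fun h => hs h.1)]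

/-- The integral over a ball has the surface integral as its derivative in the radius. -/
lemma hasDerivAt_integral_ball {n : ℕ} {f : E (n + 1) → ℝ} (hf : Continuous f)
    (y₀ : E (n + 1)) {r : ℝ} (hr : 0 < r) :
    HasDerivAt (fun s => ∫ y in ball y₀ s, f y) (sphereIntegral f y₀ r) r := by
  have hc := continuous_sphereIntegral hf y₀
  have h := intervalIntegral.integral_hasDerivAt_right (hc.intervalIntegrable 0 r)
    (hc.stronglyMeasurableAtFilter _ _) hc.continuousAt
  refine h.congr_of_eventuallyEq ?_
  filter_upwards [lt_mem_nhds hr] with s hs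
  exact integral_ball_eq_integral_sphereIntegral hf y₀ hs.le

/-! ### The divergence theorem on balls -/

/-- The partial derivative `∂ᵢ f`. -/
noncomputable def partialDeriv {m : ℕ} (i : Fin m) (f : E m → ℝ) (y : E m) : ℝ :=
  fderiv ℝ f y (EuclideanSpace.single i 1)

lemma sphereIntegral_congr {n : ℕ} {f g : E (n + 1) → ℝ} {y₀ : E (n + 1)} {r : ℝ} (hr : 0 ≤ r)
    (h : ∀ y, ‖y - y₀‖ = r → f y = g y) : sphereIntegral f y₀ r = sphereIntegral g y₀ r := by
  unfold sphereIntegral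
  congr 2
  ext ω
  exact h _ (by simp [norm_smul, abs_of_nonneg hr])

lemma sphereIntegral_const_mul {n : ℕ} (c : ℝ) (f : E (n + 1) → ℝ) (y₀ : E (n + 1)) (r : ℝ) :
    sphereIntegral (fun y => c * f y) y₀ r = c * sphereIntegral f y₀ r := by
  simp only [sphereIntegral, integral_const_mul]
  ring

lemma sphereIntegral_add {n : ℕ} {f g : E (n + 1) → ℝ} (hf : Continuous f) (hg : Continuous g)
    (y₀ : E (n + 1)) (r : ℝ) :
    sphereIntegral (fun y => f y + g y) y₀ r = sphereIntegral f y₀ r + sphereIntegral g y₀ r := by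
  simp only [sphereIntegral]
  rw [integral_add (integrable_sphere hf y₀ r) (integrable_sphere hg y₀ r)]
  ring

lemma sphereIntegral_mono {n : ℕ} {f g : E (n + 1) → ℝ} (hf : Continuous f) (hg : Continuous g)
    {y₀ : E (n + 1)} {r : ℝ} (hr : 0 ≤ r) (h : ∀ y, f y ≤ g y) :
    sphereIntegral f y₀ r ≤ sphereIntegral g y₀ r := by
  unfold sphereIntegral
  gcongr
  · exact integrable_sphere hf y₀ r
  · exact integrable_sphere hg y₀ r
  · exact fun ω => h _

lemma sphereIntegral_sum {n : ℕ} {ι : Type*} (s : Finset ι) {f : ι → E (n + 1) → ℝ}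
    (hf : ∀ i ∈ s, Continuous (f i)) (y₀ : E (n + 1)) (r : ℝ) :
    sphereIntegral (fun y => ∑ i ∈ s, f i y) y₀ r = ∑ i ∈ s, sphereIntegral (f i) y₀ r := by
  simp only [sphereIntegral]
  rw [integral_finsetSum s fun i hi => integrable_sphere (hf i hi) y₀ r, Finset.mul_sum]

/-- There is no boundary term, because the weight vanishes on `∂B_r(y₀)`. -/
lemma hasDerivAt_integral_ball_weight {n : ℕ} {f : E (n + 1) → ℝ} (hf : Continuous f)
    (y₀ : E (n + 1)) {r : ℝ} (hr : 0 < r) :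
    HasDerivAt (fun s => ∫ y in ball y₀ s, (s ^ 2 - ‖y - y₀‖ ^ 2) * f y)
      (2 * r * ∫ y in ball y₀ r, f y) r := by
  have hg : Continuous fun y => ‖y - y₀‖ ^ 2 * f y := by fun_prop
  have h1 := ((hasDerivAt_pow 2 r).mul (hasDerivAt_integral_ball hf y₀ hr)).sub
    (hasDerivAt_integral_ball hg y₀ hr)
  have h2 : sphereIntegral (fun y => ‖y - y₀‖ ^ 2 * f y) y₀ r = r ^ 2 * sphereIntegral f y₀ r := by
    rw [← sphereIntegral_const_mul]
    exact sphereIntegral_congr hr.le fun y hy => by rw [hy]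
  rw [h2] at h1
  convert! h1 using 1
  · ext s
    simp only [Pi.sub_apply, Pi.mul_apply, sub_mul]
    rw [integral_sub ((integrableOn_ball hf y₀ s).const_mul _) (integrableOn_ball hg y₀ s),
      integral_const_mul]
  · norm_num

lemma hasDerivAt_integral_ball_weight_sq {n : ℕ} {f : E (n + 1) → ℝ} (hf : Continuous f)
    (y₀ : E (n + 1)) {r : ℝ} (hr : 0 < r) :
    HasDerivAt (fun s => ∫ y in ball y₀ s, (s ^ 2 - ‖y - y₀‖ ^ 2) ^ 2 * f y)
      (4 * r * ∫ y in ball y₀ r, (r ^ 2 - ‖y - y₀‖ ^ 2) * f y) r := by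
  have hg : Continuous fun y => ‖y - y₀‖ ^ 2 * f y := by fun_prop
  have h1 := ((hasDerivAt_pow 2 r).mul (hasDerivAt_integral_ball_weight hf y₀ hr)).sub
    (hasDerivAt_integral_ball_weight hg y₀ hr)
  convert! h1 using 1
  · ext s
    have c1 : Continuous fun y => (s ^ 2 - ‖y - y₀‖ ^ 2) * f y := by fun_prop
    have c2 : Continuous fun y => (s ^ 2 - ‖y - y₀‖ ^ 2) * (‖y - y₀‖ ^ 2 * f y) := by fun_prop
    simp only [Pi.sub_apply, Pi.mul_apply]
    rw [← integral_const_mul, ← integral_sub ((integrableOn_ball c1 y₀ s).const_mul _)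
      (integrableOn_ball c2 y₀ s)]
    congr 1
    ext y
    ring
  · have : ∫ y in ball y₀ r, (r ^ 2 - ‖y - y₀‖ ^ 2) * f y
        = r ^ 2 * (∫ y in ball y₀ r, f y) - ∫ y in ball y₀ r, ‖y - y₀‖ ^ 2 * f y := by
      simp only [sub_mul]
      rw [integral_sub ((integrableOn_ball hf y₀ r).const_mul _) (integrableOn_ball hg y₀ r),
        integral_const_mul]
    rw [this]
    norm_num
    ring

lemma hasDerivAt_max_zero_sq (t : ℝ) : HasDerivAt (fun s : ℝ => max s 0 ^ 2) (2 * max t 0) t := by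
  rcases lt_trichotomy t 0 with ht | rfl | ht
  · rw [max_eq_right ht.le, mul_zero]
    refine (hasDerivAt_const t (0 : ℝ)).congr_of_eventuallyEq ?_
    filter_upwards [gt_mem_nhds ht] with s hs
    simp [max_eq_right hs.le]
  · rw [hasDerivAt_iff_isLittleO_nhds_zero]
    simp only [max_self, mul_zero, smul_zero, sub_zero, zero_add, ne_eq, OfNat.ofNat_ne_zero,
      not_false_eq_true, zero_pow]
    refine Asymptotics.IsBigO.trans_isLittleO (g := fun h : ℝ => h ^ 2) ?_
      (Asymptotics.isLittleO_pow_id one_lt_two)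
    refine Asymptotics.isBigO_of_le _ fun h => ?_
    rw [norm_pow, norm_pow]
    gcongr
    rcases le_total h 0 with hh | hh <;> simp [hh]
  · rw [max_eq_left ht.le]
    have := hasDerivAt_pow 2 t
    norm_num at this
    refine this.congr_of_eventuallyEq ?_
    filter_upwards [lt_mem_nhds ht] with s hs
    simp [max_eq_left hs.le]

/-- Integration by parts against the `C¹` compactly supported function
`max (r² - ‖y - y₀‖²) 0 ^ 2`. -/
lemma integral_ball_weight_sq_partialDeriv {n : ℕ} {f : E (n + 1) → ℝ} (hf : ContDiff ℝ 1 f)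
    (i : Fin (n + 1)) (y₀ : E (n + 1)) {r : ℝ} (hr : 0 < r) :
    ∫ y in ball y₀ r, (r ^ 2 - ‖y - y₀‖ ^ 2) ^ 2 * partialDeriv i f y
      = 4 * ∫ y in ball y₀ r, (r ^ 2 - ‖y - y₀‖ ^ 2) * ((y i - y₀ i) * f y) := by
  set q : E (n + 1) → ℝ := fun y => max (r ^ 2 - ‖y - y₀‖ ^ 2) 0 with hq
  have hqc : Continuous q := by fun_prop
  have hfc : Continuous f := hf.continuous
  have hfc' : Continuous fun y => fderiv ℝ f y (EuclideanSpace.single i 1) :=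
    (hf.continuous_fderiv one_ne_zero).clm_apply continuous_const
  have hq0 : ∀ y ∉ ball y₀ r, q y = 0 := by
    intro y hy
    rw [mem_ball, dist_eq_norm, not_lt] at hy
    refine max_eq_right ?_
    nlinarith
  have hq1 : ∀ y ∈ ball y₀ r, q y = r ^ 2 - ‖y - y₀‖ ^ 2 := by
    intro y hy
    rw [mem_ball, dist_eq_norm] at hy
    refine max_eq_left ?_
    nlinarith [norm_nonneg (y - y₀)]
  have hd : ∀ y, HasFDerivAt (fun y => q y ^ 2)
      ((2 * q y) • -((2 : ℝ) • innerSL ℝ (y - y₀))) y := by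
    intro y
    have h1 : HasFDerivAt (fun y : E (n + 1) => r ^ 2 - ‖y - y₀‖ ^ 2)
        (-((2 : ℝ) • innerSL ℝ (y - y₀))) y := by
      have := ((hasFDerivAt_id (𝕜 := ℝ) y).sub_const y₀).norm_sq
      convert! this.const_sub (r ^ 2) using 1
      ext z
      simp
    exact (hasDerivAt_max_zero_sq _).comp_hasFDerivAt y h1
  have hd' : ∀ y, fderiv ℝ (fun y => q y ^ 2) y (EuclideanSpace.single i 1)
      = -4 * (q y * (y i - y₀ i)) := by
    intro y
    rw [(hd y).fderiv]
    simp [EuclideanSpace.inner_single_right]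
    ring
  have hsupp : ∀ {k : E (n + 1) → ℝ}, Continuous k → (∀ y ∉ ball y₀ r, k y = 0) →
      Integrable k := fun hk h0 => hk.integrable_of_hasCompactSupport
    (HasCompactSupport.of_support_subset_isCompact (isCompact_closedBall y₀ r)
      fun y hy => ball_subset_closedBall (by_contra fun h => hy (h0 y h)))
  have key := integral_mul_fderiv_eq_neg_fderiv_mul_of_integrable (μ := volume)
    (f := fun y => q y ^ 2) (g := f) (v := EuclideanSpace.single i (1 : ℝ))
    (hsupp (by simp only [hd']; fun_prop) fun y hy => by simp [hd', hq0 y hy])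
    (hsupp (by fun_prop) fun y hy => by simp [hq0 y hy])
    (hsupp (by fun_prop) fun y hy => by simp [hq0 y hy])
    (fun y _ => (hd y).differentiableAt) (fun y _ => hf.differentiable one_ne_zero y)
  simp only [hd'] at key
  have restr : ∀ {k : E (n + 1) → ℝ}, (∀ y ∉ ball y₀ r, k y = 0) →
      ∫ y, k y = ∫ y in ball y₀ r, k y := fun h0 =>
    (setIntegral_eq_integral_of_forall_compl_eq_zero h0).symm
  rw [← integral_neg, restr fun y hy => by simp [hq0 y hy],
    restr (k := fun y => -(-4 * (q y * (y i - y₀ i)) * f y)) fun y hy => by simp [hq0 y hy]] at key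
  rw [← integral_const_mul]
  convert key using 1
  · refine setIntegral_congr_fun measurableSet_ball fun y hy => ?_
    simp only [hq1 y hy, partialDeriv]
  · refine setIntegral_congr_fun measurableSet_ball fun y hy => ?_
    simp only [hq1 y hy]
    ring

/-- The derivative in `r` of `integral_ball_weight_sq_partialDeriv`. -/
lemma integral_ball_weight_partialDeriv {n : ℕ} {f : E (n + 1) → ℝ} (hf : ContDiff ℝ 1 f)
    (i : Fin (n + 1)) (y₀ : E (n + 1)) {r : ℝ} (hr : 0 < r) :
    ∫ y in ball y₀ r, (r ^ 2 - ‖y - y₀‖ ^ 2) * partialDeriv i f y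
      = 2 * ∫ y in ball y₀ r, (y i - y₀ i) * f y := by
  have hfc : Continuous f := hf.continuous
  have hfc' : Continuous (partialDeriv i f) :=
    (hf.continuous_fderiv one_ne_zero).clm_apply continuous_const
  have h1 := hasDerivAt_integral_ball_weight_sq hfc' y₀ hr
  have h2 := (hasDerivAt_integral_ball_weight (f := fun y => (y i - y₀ i) * f y)
    (by fun_prop) y₀ hr).const_mul 4
  have h3 := h1.unique (h2.congr_of_eventuallyEq (by
    filter_upwards [lt_mem_nhds hr] with s hs
    exact integral_ball_weight_sq_partialDeriv hf i y₀ hs))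
  have : 4 * r ≠ 0 := by positivity
  apply mul_left_cancel₀ this
  linarith

/-- The divergence theorem on the ball `B_r(y₀)`, whose unit normal at `y` is `(y - y₀) / r`. -/
theorem mul_integral_ball_partialDeriv {n : ℕ} {f : E (n + 1) → ℝ} (hf : ContDiff ℝ 1 f)
    (i : Fin (n + 1)) (y₀ : E (n + 1)) {r : ℝ} (hr : 0 < r) :
    r * ∫ y in ball y₀ r, partialDeriv i f y
      = sphereIntegral (fun y => (y i - y₀ i) * f y) y₀ r := by
  have hfc : Continuous f := hf.continuous
  have hfc' : Continuous (partialDeriv i f) :=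
    (hf.continuous_fderiv one_ne_zero).clm_apply continuous_const
  have h1 := hasDerivAt_integral_ball_weight hfc' y₀ hr
  have h2 := (hasDerivAt_integral_ball (f := fun y => (y i - y₀ i) * f y)
    (by fun_prop) y₀ hr).const_mul 2
  have h3 := h1.unique (h2.congr_of_eventuallyEq (by
    filter_upwards [lt_mem_nhds hr] with s hs
    exact integral_ball_weight_partialDeriv hf i y₀ hs))
  linarith

/-! ### Partial derivatives -/

lemma contDiff_partialDeriv {m : ℕ} {k : WithTop ℕ∞} {f : E m → ℝ} (hf : ContDiff ℝ (k + 1) f)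
    (i : Fin m) : ContDiff ℝ k (partialDeriv i f) :=
  (hf.fderiv_right le_rfl).clm_apply contDiff_const

lemma partialDeriv_mul {m : ℕ} {f g : E m → ℝ} {y : E m} (hf : DifferentiableAt ℝ f y)
    (hg : DifferentiableAt ℝ g y) (i : Fin m) :
    partialDeriv i (fun y => f y * g y) y
      = f y * partialDeriv i g y + g y * partialDeriv i f y := by
  simp [partialDeriv, fderiv_fun_mul hf hg]

lemma partialDeriv_sub {m : ℕ} {f g : E m → ℝ} {y : E m} (hf : DifferentiableAt ℝ f y)
    (hg : DifferentiableAt ℝ g y) (i : Fin m) :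
    partialDeriv i (fun y => f y - g y) y = partialDeriv i f y - partialDeriv i g y := by
  simp [partialDeriv, fderiv_fun_sub hf hg]

lemma partialDeriv_sum {m : ℕ} {ι : Type*} {s : Finset ι} {f : ι → E m → ℝ} {y : E m}
    (hf : ∀ j ∈ s, DifferentiableAt ℝ (f j) y) (i : Fin m) :
    partialDeriv i (fun y => ∑ j ∈ s, f j y) y = ∑ j ∈ s, partialDeriv i (f j) y := by
  simp [partialDeriv, fderiv_fun_sum hf]

lemma partialDeriv_coord_sub {m : ℕ} (i j : Fin m) (y₀ y : E m) :
    partialDeriv i (fun y => y j - y₀ j) y = if i = j then 1 else 0 := by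
  have h : HasFDerivAt (fun y : E m => y j - y₀ j) (EuclideanSpace.proj j : E m →L[ℝ] ℝ) y :=
    (EuclideanSpace.proj j : E m →L[ℝ] ℝ).hasFDerivAt.sub_const _
  simp [partialDeriv, h.fderiv, PiLp.single_apply, eq_comm]

lemma partialDeriv_comm {m : ℕ} {f : E m → ℝ} (hf : ContDiff ℝ 2 f) (i j : Fin m) (y : E m) :
    partialDeriv i (partialDeriv j f) y = partialDeriv j (partialDeriv i f) y := by
  have hd : DifferentiableAt ℝ (fderiv ℝ f) y :=
    (hf.fderiv_right (m := 1) (by norm_num)).differentiable one_ne_zero y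
  have h : ∀ a b : Fin m, partialDeriv a (partialDeriv b f) y
      = fderiv ℝ (fderiv ℝ f) y (EuclideanSpace.single a 1) (EuclideanSpace.single b 1) := by
    intro a b
    unfold partialDeriv
    rw [fderiv_clm_apply hd (by fun_prop)]
    simp
  rw [h, h]
  exact (hf.contDiffAt.isSymmSndFDerivAt (by simp)) _ _

/-- `|∇f|²` in coordinates. -/
noncomputable def normSqGrad {m : ℕ} (f : E m → ℝ) (y : E m) : ℝ :=
  ∑ i, partialDeriv i f y ^ 2

/-- The unnormalized radial derivative `(y - y₀) · ∇f`. -/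
noncomputable def radialDeriv {m : ℕ} (f : E m → ℝ) (y₀ y : E m) : ℝ :=
  ∑ i, (y i - y₀ i) * partialDeriv i f y

/-- The Laplacian in coordinates. -/
noncomputable def coordLaplacian {m : ℕ} (f : E m → ℝ) (y : E m) : ℝ :=
  ∑ i, partialDeriv i (partialDeriv i f) y

lemma contDiff_normSqGrad {m : ℕ} {f : E m → ℝ} (hf : ContDiff ℝ 2 f) :
    ContDiff ℝ 1 (normSqGrad f) :=
  ContDiff.sum fun i _ => (contDiff_partialDeriv hf i).pow 2

lemma contDiff_coord_sub {m : ℕ} {k : WithTop ℕ∞} (i : Fin m) (y₀ : E m) :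
    ContDiff ℝ k fun y : E m => y i - y₀ i :=
  (EuclideanSpace.proj i : E m →L[ℝ] ℝ).contDiff.sub contDiff_const

lemma contDiff_radialDeriv {m : ℕ} {k : WithTop ℕ∞} {f : E m → ℝ} (hf : ContDiff ℝ (k + 1) f)
    (y₀ : E m) : ContDiff ℝ k (radialDeriv f y₀) :=
  ContDiff.sum fun i _ => (contDiff_coord_sub i y₀).mul (contDiff_partialDeriv hf i)

lemma continuous_coordLaplacian {m : ℕ} {f : E m → ℝ} (hf : ContDiff ℝ 2 f) :
    Continuous (coordLaplacian f) :=
  continuous_finsetSum _ fun i _ =>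
    (contDiff_partialDeriv (k := 0) (contDiff_partialDeriv (k := 1) hf i) i).continuous

lemma normSqGrad_nonneg {m : ℕ} (f : E m → ℝ) (y : E m) : 0 ≤ normSqGrad f y :=
  Finset.sum_nonneg fun _ _ => sq_nonneg _

lemma sum_coord_sub_sq {m : ℕ} (y₀ y : E m) : ∑ i, (y i - y₀ i) ^ 2 = ‖y - y₀‖ ^ 2 := by
  simp [EuclideanSpace.norm_sq_eq]

lemma radialDeriv_sq_le {m : ℕ} (f : E m → ℝ) (y₀ y : E m) :
    radialDeriv f y₀ y ^ 2 ≤ ‖y - y₀‖ ^ 2 * normSqGrad f y := by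
  rw [← sum_coord_sub_sq]
  exact Finset.sum_mul_sq_le_sq_mul_sq _ _ _

lemma radialDeriv_mul_self {m : ℕ} {f : E m → ℝ} {y : E m} (hf : DifferentiableAt ℝ f y)
    (y₀ : E m) : radialDeriv (fun y => f y * f y) y₀ y = 2 * (f y * radialDeriv f y₀ y) := by
  simp only [radialDeriv, partialDeriv_mul hf hf, Finset.mul_sum]
  exact Finset.sum_congr rfl fun i _ => by ring

lemma div_mul_partialDeriv {m : ℕ} {f : E m → ℝ} (hf : ContDiff ℝ 2 f) (y : E m) :
    ∑ i, partialDeriv i (fun y => f y * partialDeriv i f y) y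
      = normSqGrad f y + f y * coordLaplacian f y := by
  have h1 := hf.differentiable two_ne_zero y
  have h2 : ∀ i, DifferentiableAt ℝ (partialDeriv i f) y := fun i =>
    (contDiff_partialDeriv (k := 1) hf i).differentiable one_ne_zero y
  simp only [partialDeriv_mul h1 (h2 _), normSqGrad, coordLaplacian, Finset.sum_add_distrib,
    Finset.mul_sum]
  rw [add_comm]
  congr 1
  exact Finset.sum_congr rfl fun i _ => by ring

lemma div_coord_sub_mul {m : ℕ} {f : E m → ℝ} (hf : ContDiff ℝ 1 f) (y₀ y : E m) :
    ∑ i, partialDeriv i (fun y => (y i - y₀ i) * f y) y = m * f y + radialDeriv f y₀ y := by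
  have h1 := hf.differentiable one_ne_zero y
  have h2 : ∀ i, DifferentiableAt ℝ (fun y : E m => y i - y₀ i) y := fun i =>
    (contDiff_coord_sub (k := 1) i y₀).differentiable one_ne_zero y
  simp only [partialDeriv_mul (h2 _) h1, partialDeriv_coord_sub, radialDeriv,
    Finset.sum_add_distrib]
  simp
  ring

lemma partialDeriv_radialDeriv {m : ℕ} {f : E m → ℝ} (hf : ContDiff ℝ 2 f) (i : Fin m)
    (y₀ y : E m) : partialDeriv i (radialDeriv f y₀) y
      = partialDeriv i f y + ∑ j, (y j - y₀ j) * partialDeriv i (partialDeriv j f) y := by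
  have h1 : ∀ j, DifferentiableAt ℝ (partialDeriv j f) y := fun j =>
    (contDiff_partialDeriv (k := 1) hf j).differentiable one_ne_zero y
  have h2 : ∀ i, DifferentiableAt ℝ (fun y : E m => y i - y₀ i) y := fun i =>
    (contDiff_coord_sub (k := 1) i y₀).differentiable one_ne_zero y
  have h3 : partialDeriv i (radialDeriv f y₀) y
      = ∑ j, partialDeriv i (fun y => (y j - y₀ j) * partialDeriv j f y) y :=
    partialDeriv_sum (fun j _ => (h2 j).fun_mul (h1 j)) i
  rw [h3]
  simp only [partialDeriv_mul (h2 _) (h1 _), partialDeriv_coord_sub, Finset.sum_add_distrib]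
  simp
  ring

lemma radialDeriv_normSqGrad {m : ℕ} {f : E m → ℝ} (hf : ContDiff ℝ 2 f) (y₀ y : E m) :
    radialDeriv (normSqGrad f) y₀ y = 2 * ∑ i, partialDeriv i f y *
      ∑ j, (y j - y₀ j) * partialDeriv i (partialDeriv j f) y := by
  have h1 : ∀ j, DifferentiableAt ℝ (partialDeriv j f) y := fun j =>
    (contDiff_partialDeriv (k := 1) hf j).differentiable one_ne_zero y
  have h3 : ∀ j, partialDeriv j (normSqGrad f) y
      = ∑ i, 2 * (partialDeriv i f y * partialDeriv i (partialDeriv j f) y) := by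
    intro j
    have : normSqGrad f = fun y => ∑ i, partialDeriv i f y * partialDeriv i f y := by
      ext z
      simp [normSqGrad, sq]
    rw [this, partialDeriv_sum (fun i _ => (h1 i).fun_mul (h1 i)) j]
    refine Finset.sum_congr rfl fun i _ => ?_
    rw [partialDeriv_mul (h1 i) (h1 i), partialDeriv_comm hf j i]
    ring
  simp only [radialDeriv, h3, Finset.mul_sum]
  rw [Finset.sum_comm]
  exact Finset.sum_congr rfl fun i _ => Finset.sum_congr rfl fun j _ => by ring

/-- The divergence of the vector field `|∇f|² (y - y₀) - 2 ((y - y₀) · ∇f) ∇f`: the third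
derivatives cancel. -/
lemma div_rellich {m : ℕ} {f : E m → ℝ} (hf : ContDiff ℝ 2 f) (y₀ y : E m) :
    ∑ i, partialDeriv i (fun y => (y i - y₀ i) * normSqGrad f y
        - 2 * radialDeriv f y₀ y * partialDeriv i f y) y
      = (m - 2) * normSqGrad f y - 2 * (radialDeriv f y₀ y * coordLaplacian f y) := by
  have h1 : ∀ j, DifferentiableAt ℝ (partialDeriv j f) y := fun j =>
    (contDiff_partialDeriv (k := 1) hf j).differentiable one_ne_zero y
  have h2 : ∀ i, DifferentiableAt ℝ (fun y : E m => y i - y₀ i) y := fun i =>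
    (contDiff_coord_sub (k := 1) i y₀).differentiable one_ne_zero y
  have h3 : DifferentiableAt ℝ (normSqGrad f) y :=
    (contDiff_normSqGrad hf).differentiable one_ne_zero y
  have h4 : DifferentiableAt ℝ (radialDeriv f y₀) y :=
    (contDiff_radialDeriv (k := 1) hf y₀).differentiable one_ne_zero y
  have h5 : DifferentiableAt ℝ (fun y => 2 * radialDeriv f y₀ y) y := h4.const_mul 2
  have h6 : ∀ i, partialDeriv i (fun y => 2 * radialDeriv f y₀ y) y
      = 2 * partialDeriv i (radialDeriv f y₀) y := by
    intro i
    simp [partialDeriv, fderiv_const_mul h4]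
  simp only [partialDeriv_sub ((h2 _).fun_mul h3) (h5.fun_mul (h1 _)), Finset.sum_sub_distrib,
    div_coord_sub_mul (contDiff_normSqGrad hf), partialDeriv_mul h5 (h1 _), h6,
    partialDeriv_radialDeriv hf, radialDeriv_normSqGrad hf, Finset.sum_add_distrib,
    ← Finset.mul_sum]
  have h7 : ∑ i, partialDeriv i f y * (2 * (partialDeriv i f y
      + ∑ j, (y j - y₀ j) * partialDeriv i (partialDeriv j f) y))
      = 2 * normSqGrad f y + 2 * ∑ i, partialDeriv i f y *
        ∑ j, (y j - y₀ j) * partialDeriv i (partialDeriv j f) y := by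
    simp only [normSqGrad]
    rw [Finset.mul_sum, Finset.mul_sum, ← Finset.sum_add_distrib]
    exact Finset.sum_congr rfl fun i _ => by ring
  rw [h7]
  simp only [coordLaplacian]
  ring

/-! ### Integral identities of Green and Rellich type -/

lemma integral_ball_add {n : ℕ} {f g : E (n + 1) → ℝ} (hf : Continuous f) (hg : Continuous g)
    (y₀ : E (n + 1)) (r : ℝ) : ∫ y in ball y₀ r, (f y + g y)
      = (∫ y in ball y₀ r, f y) + ∫ y in ball y₀ r, g y :=
  integral_add (integrableOn_ball hf y₀ r) (integrableOn_ball hg y₀ r)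

lemma integral_ball_sub {n : ℕ} {f g : E (n + 1) → ℝ} (hf : Continuous f) (hg : Continuous g)
    (y₀ : E (n + 1)) (r : ℝ) : ∫ y in ball y₀ r, (f y - g y)
      = (∫ y in ball y₀ r, f y) - ∫ y in ball y₀ r, g y :=
  integral_sub (integrableOn_ball hf y₀ r) (integrableOn_ball hg y₀ r)

lemma integral_ball_mono {n : ℕ} {f g : E (n + 1) → ℝ} (hf : Continuous f) (hg : Continuous g)
    {y₀ : E (n + 1)} {r : ℝ} (h : ∀ y ∈ ball y₀ r, f y ≤ g y) :
    ∫ y in ball y₀ r, f y ≤ ∫ y in ball y₀ r, g y :=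
  setIntegral_mono_on (integrableOn_ball hf y₀ r) (integrableOn_ball hg y₀ r) measurableSet_ball h

lemma continuous_partialDeriv {m : ℕ} {f : E m → ℝ} (hf : ContDiff ℝ 1 f) (i : Fin m) :
    Continuous (partialDeriv i f) :=
  (contDiff_partialDeriv (k := 0) hf i).continuous

lemma mul_integral_ball_div {n : ℕ} {X : Fin (n + 1) → E (n + 1) → ℝ}
    (hX : ∀ i, ContDiff ℝ 1 (X i)) (y₀ : E (n + 1)) {r : ℝ} (hr : 0 < r) :
    r * ∫ y in ball y₀ r, ∑ i, partialDeriv i (X i) y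
      = sphereIntegral (fun y => ∑ i, (y i - y₀ i) * X i y) y₀ r := by
  rw [integral_finsetSum _ fun i _ =>
      integrableOn_ball (continuous_partialDeriv (hX i) i) y₀ r, Finset.mul_sum,
    sphereIntegral_sum _ fun i _ =>
      ((contDiff_coord_sub (k := 1) i y₀).mul (hX i)).continuous]
  exact Finset.sum_congr rfl fun i _ => mul_integral_ball_partialDeriv (hX i) i y₀ hr

lemma integral_ball_weight_div {n : ℕ} {X : Fin (n + 1) → E (n + 1) → ℝ}
    (hX : ∀ i, ContDiff ℝ 1 (X i)) (y₀ : E (n + 1)) {r : ℝ} (hr : 0 < r) :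
    ∫ y in ball y₀ r, (r ^ 2 - ‖y - y₀‖ ^ 2) * ∑ i, partialDeriv i (X i) y
      = 2 * ∫ y in ball y₀ r, ∑ i, (y i - y₀ i) * X i y := by
  have hc : ∀ i, Continuous (partialDeriv i (X i)) := fun i => continuous_partialDeriv (hX i) i
  simp only [Finset.mul_sum]
  rw [integral_finsetSum _ fun i _ => integrableOn_ball
      (f := fun y => (r ^ 2 - ‖y - y₀‖ ^ 2) * partialDeriv i (X i) y)
      (by have := hc i; fun_prop) y₀ r,
    integral_finsetSum _ fun i _ => integrableOn_ball
      ((contDiff_coord_sub (k := 1) i y₀).mul (hX i)).continuous y₀ r, Finset.mul_sum]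
  exact Finset.sum_congr rfl fun i _ => integral_ball_weight_partialDeriv (hX i) i y₀ hr

/-- Green's identity `∫_{B_r} (|∇w|² + w Δw) = ∫_{∂B_r} w ∂_ν w`. -/
lemma mul_integral_ball_green {n : ℕ} {w : E (n + 1) → ℝ} (hw : ContDiff ℝ 2 w)
    (y₀ : E (n + 1)) {r : ℝ} (hr : 0 < r) :
    r * ∫ y in ball y₀ r, (normSqGrad w y + w y * coordLaplacian w y)
      = sphereIntegral (fun y => w y * radialDeriv w y₀ y) y₀ r := by
  have h := mul_integral_ball_div (X := fun i y => w y * partialDeriv i w y)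
    (fun i => (hw.of_le one_le_two).mul (contDiff_partialDeriv hw i)) y₀ hr
  simp only [div_mul_partialDeriv hw] at h
  rw [h]
  congr 1
  ext y
  rw [radialDeriv, Finset.mul_sum]
  exact Finset.sum_congr rfl fun i _ => by ring

/-- Green's identity against the weight `r² - ‖y - y₀‖²`, which has no boundary term. -/
lemma integral_ball_weight_green {n : ℕ} {w : E (n + 1) → ℝ} (hw : ContDiff ℝ 2 w)
    (y₀ : E (n + 1)) {r : ℝ} (hr : 0 < r) :
    ∫ y in ball y₀ r, (r ^ 2 - ‖y - y₀‖ ^ 2) * (normSqGrad w y + w y * coordLaplacian w y)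
      = 2 * ∫ y in ball y₀ r, w y * radialDeriv w y₀ y := by
  have h := integral_ball_weight_div (X := fun i y => w y * partialDeriv i w y)
    (fun i => (hw.of_le one_le_two).mul (contDiff_partialDeriv hw i)) y₀ hr
  simp only [div_mul_partialDeriv hw] at h
  rw [h]
  congr 2
  ext y
  rw [radialDeriv, Finset.mul_sum]
  exact Finset.sum_congr rfl fun i _ => by ring

/-- The divergence theorem for the vector field `f (y - y₀)`. -/
lemma integral_ball_dilation {n : ℕ} {f : E (n + 1) → ℝ} (hf : ContDiff ℝ 1 f)
    (y₀ : E (n + 1)) {r : ℝ} (hr : 0 < r) :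
    ∫ y in ball y₀ r, ((n + 1) * f y + radialDeriv f y₀ y) = r * sphereIntegral f y₀ r := by
  have h := mul_integral_ball_div (X := fun i y => (y i - y₀ i) * f y)
    (fun i => (contDiff_coord_sub i y₀).mul hf) y₀ hr
  simp only [div_coord_sub_mul hf] at h
  have h2 : sphereIntegral (fun y => ∑ i, (y i - y₀ i) * ((y i - y₀ i) * f y)) y₀ r
      = r ^ 2 * sphereIntegral f y₀ r := by
    rw [← sphereIntegral_const_mul]
    refine sphereIntegral_congr hr.le fun y hy => ?_
    rw [← hy, ← sum_coord_sub_sq, Finset.sum_mul]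
    exact Finset.sum_congr rfl fun i _ => by ring
  rw [h2] at h
  apply mul_left_cancel₀ hr.ne'
  push_cast at h
  rw [h]
  ring

/-- The derivative of a surface integral in the radius, obtained by differentiating
`integral_ball_dilation` instead of differentiating under the integral sign. -/
lemma hasDerivAt_sphereIntegral {n : ℕ} {f : E (n + 1) → ℝ} (hf : ContDiff ℝ 1 f)
    (y₀ : E (n + 1)) {r : ℝ} (hr : 0 < r) :
    HasDerivAt (sphereIntegral f y₀)
      ((n * sphereIntegral f y₀ r + sphereIntegral (radialDeriv f y₀) y₀ r) / r) r := by
  have hc : Continuous f := hf.continuous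
  have hc' : Continuous (radialDeriv f y₀) := (contDiff_radialDeriv (k := 0) hf y₀).continuous
  have h1 := (hasDerivAt_integral_ball
    (f := fun y => (n + 1) * f y + radialDeriv f y₀ y) (by fun_prop) y₀ hr).div
    (hasDerivAt_id r) hr.ne'
  have h2 := h1.congr_of_eventuallyEq (f₁ := sphereIntegral f y₀) (by
    filter_upwards [lt_mem_nhds hr] with s hs
    simp only [Pi.div_apply, id]
    rw [integral_ball_dilation hf y₀ hs]
    field_simp)
  convert! h2 using 1
  rw [integral_ball_dilation hf y₀ hr, sphereIntegral_add (by fun_prop) hc',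
    sphereIntegral_const_mul]
  simp only [id]
  field_simp
  ring

/-- Rellich's identity on the ball `B_r(y₀)`. -/
lemma rellich_ball {n : ℕ} {w : E (n + 1) → ℝ} (hw : ContDiff ℝ 2 w)
    (y₀ : E (n + 1)) {r : ℝ} (hr : 0 < r) :
    r ^ 2 * sphereIntegral (normSqGrad w) y₀ r
      = r * (n - 1) * (∫ y in ball y₀ r, normSqGrad w y)
        + 2 * sphereIntegral (fun y => radialDeriv w y₀ y ^ 2) y₀ r
        - 2 * r * ∫ y in ball y₀ r, radialDeriv w y₀ y * coordLaplacian w y := by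
  have h := mul_integral_ball_div (X := fun i y => (y i - y₀ i) * normSqGrad w y
        - 2 * radialDeriv w y₀ y * partialDeriv i w y)
    (fun i => ((contDiff_coord_sub i y₀).mul (contDiff_normSqGrad hw)).sub
      ((contDiff_const.mul (contDiff_radialDeriv hw y₀)).mul (contDiff_partialDeriv hw i))) y₀ hr
  have c1 : Continuous (normSqGrad w) := (contDiff_normSqGrad hw).continuous
  have c2 : Continuous (radialDeriv w y₀) := (contDiff_radialDeriv (k := 1) hw y₀).continuous
  have c3 : Continuous (coordLaplacian w) := continuous_coordLaplacian hw
  simp only [div_rellich hw] at h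
  have h2 : sphereIntegral (fun y => ∑ i, (y i - y₀ i) * ((y i - y₀ i) * normSqGrad w y
        - 2 * radialDeriv w y₀ y * partialDeriv i w y)) y₀ r
      = r ^ 2 * sphereIntegral (normSqGrad w) y₀ r
        + -2 * sphereIntegral (fun y => radialDeriv w y₀ y ^ 2) y₀ r := by
    rw [← sphereIntegral_const_mul, ← sphereIntegral_const_mul,
      ← sphereIntegral_add (by fun_prop) (by fun_prop)]
    refine sphereIntegral_congr hr.le fun y hy => ?_
    have e : radialDeriv w y₀ y ^ 2
        = radialDeriv w y₀ y * ∑ i, (y i - y₀ i) * partialDeriv i w y := sq _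
    rw [e, ← hy, ← sum_coord_sub_sq, Finset.sum_mul, Finset.mul_sum, Finset.mul_sum,
      ← Finset.sum_add_distrib]
    exact Finset.sum_congr rfl fun i _ => by ring
  rw [h2, integral_ball_sub (by fun_prop) (by fun_prop), integral_const_mul,
    integral_const_mul] at h
  push_cast at h
  linarith

/-- The mean value bound `(n + 1) ∫_{B_r} w² ≤ r ∫_{∂B_r} w²` for a function `w` that is harmonic in
the ball. -/
lemma integral_ball_sq_le_of_harmonic {n : ℕ} {w : E (n + 1) → ℝ} (hw : ContDiff ℝ 2 w)
    {y₀ : E (n + 1)} {r : ℝ} (hr : 0 < r) (hΔ : ∀ y ∈ ball y₀ r, coordLaplacian w y = 0) :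
    (n + 1) * ∫ y in ball y₀ r, w y ^ 2 ≤ r * sphereIntegral (fun y => w y ^ 2) y₀ r := by
  have c0 : Continuous w := hw.continuous
  have c2 : Continuous (radialDeriv w y₀) := (contDiff_radialDeriv (k := 1) hw y₀).continuous
  have hw1 : ContDiff ℝ 1 w := hw.of_le one_le_two
  have h1 := integral_ball_dilation (f := fun y => w y * w y) (hw1.mul hw1) y₀ hr
  simp only [radialDeriv_mul_self (hw1.differentiable one_ne_zero _)] at h1
  rw [integral_ball_add (by fun_prop) (by fun_prop), integral_const_mul, integral_const_mul,
    ← integral_ball_weight_green hw y₀ hr] at h1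
  have h2 : 0 ≤ ∫ y in ball y₀ r,
      (r ^ 2 - ‖y - y₀‖ ^ 2) * (normSqGrad w y + w y * coordLaplacian w y) := by
    refine setIntegral_nonneg measurableSet_ball fun y hy => ?_
    rw [hΔ y hy, mul_zero, add_zero]
    rw [mem_ball, dist_eq_norm] at hy
    refine mul_nonneg ?_ (normSqGrad_nonneg w y)
    nlinarith [norm_nonneg (y - y₀)]
  simp only [sq (w _)]
  linarith

/-- The Cauchy-Schwarz inequality for pairs of functions on a sphere. -/
lemma sphereIntegral_cauchySchwarz {n : ℕ} {a b p q : E (n + 1) → ℝ} (ha : Continuous a)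
    (hb : Continuous b) (hp : Continuous p) (hq : Continuous q) {y₀ : E (n + 1)} {r : ℝ}
    (hr : 0 ≤ r) :
    sphereIntegral (fun y => a y * p y + b y * q y) y₀ r ^ 2
      ≤ sphereIntegral (fun y => a y ^ 2 + b y ^ 2) y₀ r
        * sphereIntegral (fun y => p y ^ 2 + q y ^ 2) y₀ r := by
  set A := sphereIntegral (fun y => a y ^ 2 + b y ^ 2) y₀ r
  set B := sphereIntegral (fun y => a y * p y + b y * q y) y₀ r
  set C := sphereIntegral (fun y => p y ^ 2 + q y ^ 2) y₀ r
  have h : ∀ t : ℝ, 0 ≤ A * (t * t) + 2 * B * t + C := by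
    intro t
    have h1 : sphereIntegral (fun y => (t * a y + p y) ^ 2 + (t * b y + q y) ^ 2) y₀ r
        = t * t * A + (2 * t * B + C) := by
      rw [← sphereIntegral_const_mul, ← sphereIntegral_const_mul,
        ← sphereIntegral_add (by fun_prop) (by fun_prop),
        ← sphereIntegral_add (by fun_prop) (by fun_prop)]
      congr 1
      ext y
      ring
    have h2 : 0 ≤ sphereIntegral (fun y => (t * a y + p y) ^ 2 + (t * b y + q y) ^ 2) y₀ r :=
      mul_nonneg (pow_nonneg hr n) (integral_nonneg fun ω => by positivity)
    linarith
  have := discrim_le_zero h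
  rw [discrim] at this
  linarith

/-! ### The frequency of a coupled pair -/

/-- A pair of globally `C²` functions satisfying `Δg = 2 lam g + h` and `Δh = 0` on `B_R(y₀)`.
Nothing is required of their Laplacians outside this ball. -/
structure IsCoupledPair {n : ℕ} (lam : ℝ) (y₀ : E (n + 1)) (R : ℝ) (g h : E (n + 1) → ℝ) :
    Prop where
  one_lt : 1 < lam
  contDiff_left : ContDiff ℝ 2 g
  contDiff_right : ContDiff ℝ 2 h
  laplacian_left : ∀ y ∈ ball y₀ R, coordLaplacian g y = 2 * lam * g y + h y
  laplacian_right : ∀ y ∈ ball y₀ R, coordLaplacian h y = 0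

/-- The integrand of the energy of the pair `(g, h)`. -/
noncomputable def energyDensity {n : ℕ} (lam : ℝ) (g h : E (n + 1) → ℝ) (y : E (n + 1)) : ℝ :=
  normSqGrad g y + normSqGrad h y + g y * h y + 2 * lam * g y ^ 2

/-- The energy of the pair `(g, h)` on `B_r(y₀)`. -/
noncomputable def energy {n : ℕ} (lam : ℝ) (g h : E (n + 1) → ℝ) (y₀ : E (n + 1)) (r : ℝ) : ℝ :=
  ∫ y in ball y₀ r, energyDensity lam g h y

/-- The squared `L²` norm of the pair `(g, h)` on `∂B_r(y₀)`. -/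
noncomputable def height {n : ℕ} (g h : E (n + 1) → ℝ) (y₀ : E (n + 1)) (r : ℝ) : ℝ :=
  sphereIntegral (fun y => g y ^ 2 + h y ^ 2) y₀ r

/-- The frequency of the pair `(g, h)`; it is `0` where the height vanishes. -/
noncomputable def frequency {n : ℕ} (lam : ℝ) (g h : E (n + 1) → ℝ) (y₀ : E (n + 1)) (r : ℝ) : ℝ :=
  r * (energy lam g h y₀ r / height g h y₀ r)

lemma height_nonneg {n : ℕ} (g h : E (n + 1) → ℝ) (y₀ : E (n + 1)) {r : ℝ} (hr : 0 ≤ r) :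
    0 ≤ height g h y₀ r :=
  mul_nonneg (pow_nonneg hr n) (integral_nonneg fun ω => by positivity)

namespace IsCoupledPair

variable {n : ℕ} {lam : ℝ} {y₀ : E (n + 1)} {R : ℝ} {g h : E (n + 1) → ℝ}

lemma continuous_left (P : IsCoupledPair lam y₀ R g h) : Continuous g :=
  P.contDiff_left.continuous

lemma continuous_right (P : IsCoupledPair lam y₀ R g h) : Continuous h :=
  P.contDiff_right.continuous

lemma continuous_normSqGrad_left (P : IsCoupledPair lam y₀ R g h) : Continuous (normSqGrad g) :=
  (contDiff_normSqGrad P.contDiff_left).continuous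

lemma continuous_normSqGrad_right (P : IsCoupledPair lam y₀ R g h) : Continuous (normSqGrad h) :=
  (contDiff_normSqGrad P.contDiff_right).continuous

lemma continuous_radialDeriv_left (P : IsCoupledPair lam y₀ R g h) :
    Continuous (radialDeriv g y₀) :=
  (contDiff_radialDeriv (k := 1) P.contDiff_left y₀).continuous

lemma continuous_radialDeriv_right (P : IsCoupledPair lam y₀ R g h) :
    Continuous (radialDeriv h y₀) :=
  (contDiff_radialDeriv (k := 1) P.contDiff_right y₀).continuous

lemma continuous_energyDensity (P : IsCoupledPair lam y₀ R g h) :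
    Continuous (energyDensity lam g h) := by
  have := P.continuous_left
  have := P.continuous_right
  have := P.continuous_normSqGrad_left
  have := P.continuous_normSqGrad_right
  unfold energyDensity
  fun_prop

/-- The energy as a boundary integral. -/
lemma mul_energy (P : IsCoupledPair lam y₀ R g h) {r : ℝ} (hr : 0 < r) (hrR : r ≤ R) :
    r * energy lam g h y₀ r
      = sphereIntegral (fun y => g y * radialDeriv g y₀ y + h y * radialDeriv h y₀ y) y₀ r := by
  have c1 := P.continuous_left
  have c2 := P.continuous_right
  have c3 := P.continuous_normSqGrad_left
  have c4 := P.continuous_normSqGrad_right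
  have c5 := P.continuous_radialDeriv_left
  have c6 := P.continuous_radialDeriv_right
  have c7 := continuous_coordLaplacian P.contDiff_left
  have c8 := continuous_coordLaplacian P.contDiff_right
  rw [sphereIntegral_add (by fun_prop) (by fun_prop),
    ← mul_integral_ball_green P.contDiff_left y₀ hr,
    ← mul_integral_ball_green P.contDiff_right y₀ hr, ← mul_add,
    ← integral_ball_add (by fun_prop) (by fun_prop), energy]
  congr 1
  refine setIntegral_congr_fun measurableSet_ball fun y hy => ?_
  have hy' := ball_subset_ball hrR hy
  simp only [energyDensity, P.laplacian_left y hy', P.laplacian_right y hy']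
  ring

lemma hasDerivAt_height (P : IsCoupledPair lam y₀ R g h) {r : ℝ} (hr : 0 < r) (hrR : r ≤ R) :
    HasDerivAt (height g h y₀) (n * height g h y₀ r / r + 2 * energy lam g h y₀ r) r := by
  have d1 : ContDiff ℝ 1 g := P.contDiff_left.of_le one_le_two
  have d2 : ContDiff ℝ 1 h := P.contDiff_right.of_le one_le_two
  have c1 := P.continuous_left
  have c2 := P.continuous_right
  have c5 := P.continuous_radialDeriv_left
  have c6 := P.continuous_radialDeriv_right
  have h1 := (hasDerivAt_sphereIntegral (d1.mul d1) y₀ hr).add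
    (hasDerivAt_sphereIntegral (d2.mul d2) y₀ hr)
  convert! h1 using 1
  · ext s
    rw [Pi.add_apply, ← sphereIntegral_add (by fun_prop) (by fun_prop), height]
    simp only [sq]
  · have e1 : height g h y₀ r = sphereIntegral (fun y => g y * g y) y₀ r
        + sphereIntegral (fun y => h y * h y) y₀ r := by
      rw [← sphereIntegral_add (by fun_prop) (by fun_prop), height]
      simp only [sq]
    have e2 := P.mul_energy hr hrR
    rw [sphereIntegral_add (by fun_prop) (by fun_prop)] at e2
    have e3 : ∀ {w : E (n + 1) → ℝ}, ContDiff ℝ 1 w →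
        sphereIntegral (radialDeriv (fun y => w y * w y) y₀) y₀ r
          = 2 * sphereIntegral (fun y => w y * radialDeriv w y₀ y) y₀ r := by
      intro w hw
      rw [← sphereIntegral_const_mul]
      congr 1
      ext y
      exact radialDeriv_mul_self (hw.differentiable one_ne_zero y) y₀
    rw [e3 d1, e3 d2, e1]
    field_simp
    linarith

lemma hasDerivAt_energy (P : IsCoupledPair lam y₀ R g h) {r : ℝ} (hr : 0 < r) :
    HasDerivAt (energy lam g h y₀) (sphereIntegral (energyDensity lam g h) y₀ r) r :=
  hasDerivAt_integral_ball P.continuous_energyDensity y₀ hr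

lemma integral_right_sq_le (P : IsCoupledPair lam y₀ R g h) {r : ℝ} (hr : 0 < r) (hrR : r ≤ R) :
    ∫ y in ball y₀ r, h y ^ 2 ≤ r * height g h y₀ r := by
  have c1 := P.continuous_left
  have c2 := P.continuous_right
  have h1 := integral_ball_sq_le_of_harmonic P.contDiff_right hr
    (fun y hy => P.laplacian_right y (ball_subset_ball hrR hy))
  have h2 : sphereIntegral (fun y => h y ^ 2) y₀ r ≤ height g h y₀ r :=
    sphereIntegral_mono (by fun_prop) (by fun_prop) hr.le
      fun y => le_add_of_nonneg_left (sq_nonneg _)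
  have h3 : 0 ≤ ∫ y in ball y₀ r, h y ^ 2 := integral_nonneg fun y => sq_nonneg _
  have h4 : (0 : ℝ) ≤ n := n.cast_nonneg
  nlinarith

/-- The energy controls the `H¹` norm of `g` up to the `L²` norm of `h`; here `lam > 1` absorbs the
indefinite term `g h`. -/
lemma integral_normSqGrad_add_integral_sq_le (P : IsCoupledPair lam y₀ R g h) (r : ℝ) :
    (∫ y in ball y₀ r, normSqGrad g y) + (∫ y in ball y₀ r, g y ^ 2)
      ≤ energy lam g h y₀ r + (∫ y in ball y₀ r, h y ^ 2) / 4 := by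
  have c1 := P.continuous_left
  have c2 := P.continuous_right
  have c3 := P.continuous_normSqGrad_left
  have c4 := P.continuous_energyDensity
  rw [← integral_ball_add (by fun_prop) (by fun_prop), ← integral_div, energy,
    ← integral_ball_add (by fun_prop) (by fun_prop)]
  refine integral_ball_mono (by fun_prop) (by fun_prop) fun y _ => ?_
  have h1 := normSqGrad_nonneg h y
  have h2 : 1 * g y ^ 2 ≤ lam * g y ^ 2 :=
    mul_le_mul_of_nonneg_right P.one_lt.le (sq_nonneg _)
  simp only [energyDensity]
  nlinarith [sq_nonneg (g y + h y / 2)]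

lemma sq_mul_energy_le (P : IsCoupledPair lam y₀ R g h) {r : ℝ} (hr : 0 < r) (hrR : r ≤ R) :
    (r * energy lam g h y₀ r) ^ 2 ≤ height g h y₀ r *
      sphereIntegral (fun y => radialDeriv g y₀ y ^ 2 + radialDeriv h y₀ y ^ 2) y₀ r := by
  rw [P.mul_energy hr hrR]
  exact sphereIntegral_cauchySchwarz P.continuous_left P.continuous_right
    P.continuous_radialDeriv_left P.continuous_radialDeriv_right hr.le

/-- If both functions vanish on a sphere, they vanish in the ball. -/
lemma height_eq_zero_of_lt (P : IsCoupledPair lam y₀ R g h) {s r : ℝ} (hs : 0 < s) (hsr : s < r)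
    (hrR : r ≤ R) (h0 : height g h y₀ r = 0) : height g h y₀ s = 0 := by
  have hr := hs.trans hsr
  have c1 := P.continuous_left
  have c2 := P.continuous_right
  have hE : energy lam g h y₀ r = 0 := by
    have := P.sq_mul_energy_le hr hrR
    rw [h0, zero_mul] at this
    have := pow_eq_zero_iff two_ne_zero |>.1 (le_antisymm this (sq_nonneg _))
    exact (mul_eq_zero.1 this).resolve_left hr.ne'
  have h1 := P.integral_right_sq_le hr hrR
  have h2 := P.integral_normSqGrad_add_integral_sq_le r
  have h3 : 0 ≤ ∫ y in ball y₀ r, normSqGrad g y := integral_nonneg fun y => normSqGrad_nonneg g y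
  have cq : Continuous fun y => g y ^ 2 + h y ^ 2 := by fun_prop
  have h4 : ∫ y in ball y₀ r, (g y ^ 2 + h y ^ 2) ≤ 0 := by
    rw [integral_ball_add (by fun_prop) (by fun_prop)]
    have : 0 ≤ ∫ y in ball y₀ r, h y ^ 2 := integral_nonneg fun y => sq_nonneg _
    rw [h0] at h1
    linarith
  have h5 := hasDerivAt_integral_ball cq y₀ hs
  refine h5.unique ((hasDerivAt_const s (0 : ℝ)).congr_of_eventuallyEq ?_)
  filter_upwards [gt_mem_nhds hsr] with t ht
  refine le_antisymm (le_trans ?_ h4) (integral_nonneg fun y => by positivity)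
  exact setIntegral_mono_set (integrableOn_ball cq y₀ r) (.of_forall fun y => by positivity)
    (ball_subset_ball ht.le).eventuallyLE

/-- The Rellich identity for the energy. The terms `2 lam ∫_{∂B_r} g²` cancel, which makes the
remainder independent of `lam` up to a nonnegative summand. -/
lemma sq_mul_sphereIntegral_energyDensity (P : IsCoupledPair lam y₀ R g h) {r : ℝ} (hr : 0 < r)
    (hrR : r ≤ R) :
    r ^ 2 * sphereIntegral (energyDensity lam g h) y₀ r
      = r * (n - 1) * energy lam g h y₀ r
        + 2 * sphereIntegral (fun y => radialDeriv g y₀ y ^ 2 + radialDeriv h y₀ y ^ 2) y₀ r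
        + r * (4 * lam * (∫ y in ball y₀ r, g y ^ 2) - (n - 1) * (∫ y in ball y₀ r, g y * h y)
          - 2 * (∫ y in ball y₀ r, radialDeriv g y₀ y * h y)
          + r * sphereIntegral (fun y => g y * h y) y₀ r) := by
  have d1 : ContDiff ℝ 1 g := P.contDiff_left.of_le one_le_two
  have c1 := P.continuous_left
  have c2 := P.continuous_right
  have c3 := P.continuous_normSqGrad_left
  have c4 := P.continuous_normSqGrad_right
  have c5 := P.continuous_radialDeriv_left
  have c6 := P.continuous_radialDeriv_right
  have e1 := rellich_ball P.contDiff_left y₀ hr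
  have e2 := rellich_ball P.contDiff_right y₀ hr
  have e3 : ∫ y in ball y₀ r, radialDeriv g y₀ y * coordLaplacian g y
      = 2 * lam * (∫ y in ball y₀ r, g y * radialDeriv g y₀ y)
        + ∫ y in ball y₀ r, radialDeriv g y₀ y * h y := by
    rw [← integral_const_mul, ← integral_ball_add (by fun_prop) (by fun_prop)]
    refine setIntegral_congr_fun measurableSet_ball fun y hy => ?_
    simp only [P.laplacian_left y (ball_subset_ball hrR hy)]
    ring
  have e4 : ∫ y in ball y₀ r, radialDeriv h y₀ y * coordLaplacian h y = 0 := by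
    refine setIntegral_eq_zero_of_forall_eq_zero fun y hy => ?_
    rw [P.laplacian_right y (ball_subset_ball hrR hy), mul_zero]
  have e5 := integral_ball_dilation (f := fun y => g y * g y) (d1.mul d1) y₀ hr
  simp only [radialDeriv_mul_self (d1.differentiable one_ne_zero _)] at e5
  simp only [← sq (g _)] at e5
  rw [integral_ball_add (by fun_prop) (by fun_prop), integral_const_mul, integral_const_mul] at e5
  have e6 : sphereIntegral (energyDensity lam g h) y₀ r = sphereIntegral (normSqGrad g) y₀ r
      + sphereIntegral (normSqGrad h) y₀ r + sphereIntegral (fun y => g y * h y) y₀ r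
      + 2 * lam * sphereIntegral (fun y => g y ^ 2) y₀ r := by
    rw [← sphereIntegral_const_mul, ← sphereIntegral_add (by fun_prop) (by fun_prop),
      ← sphereIntegral_add (by fun_prop) (by fun_prop),
      ← sphereIntegral_add (by fun_prop) (by fun_prop)]
    rfl
  have e7 : energy lam g h y₀ r = (∫ y in ball y₀ r, normSqGrad g y)
      + (∫ y in ball y₀ r, normSqGrad h y) + (∫ y in ball y₀ r, g y * h y)
      + 2 * lam * (∫ y in ball y₀ r, g y ^ 2) := by
    rw [← integral_const_mul, ← integral_ball_add (by fun_prop) (by fun_prop),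
      ← integral_ball_add (by fun_prop) (by fun_prop),
      ← integral_ball_add (by fun_prop) (by fun_prop)]
    rfl
  rw [sphereIntegral_add (by fun_prop) (by fun_prop), e6, e7]
  rw [e3] at e1
  rw [e4] at e2
  linear_combination e1 + e2 - 2 * lam * r * e5

/-- The remainder in the Rellich identity for the energy is at least a multiple of the energy once
the height is at most `r` times the energy. -/
lemma remainder_lower_bound (P : IsCoupledPair lam y₀ R g h) (hn : 1 ≤ n) {r : ℝ} (hr : 0 < r)
    (hr1 : r ≤ 1) (hrR : r ≤ R) (hH : height g h y₀ r ≤ r * energy lam g h y₀ r) :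
    -((2 * n + 2) * (r * energy lam g h y₀ r)) ≤
      4 * lam * (∫ y in ball y₀ r, g y ^ 2) - (n - 1) * (∫ y in ball y₀ r, g y * h y)
          - 2 * (∫ y in ball y₀ r, radialDeriv g y₀ y * h y)
          + r * sphereIntegral (fun y => g y * h y) y₀ r := by
  have c1 := P.continuous_left
  have c2 := P.continuous_right
  have c3 := P.continuous_normSqGrad_left
  have c5 := P.continuous_radialDeriv_left
  have h1 := P.integral_right_sq_le hr hrR
  have h2 := P.integral_normSqGrad_add_integral_sq_le r
  have hH0 := height_nonneg g h y₀ hr.le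
  have b1 : 2 * r * (∫ y in ball y₀ r, g y * h y)
      ≤ r ^ 2 * (∫ y in ball y₀ r, g y ^ 2) + ∫ y in ball y₀ r, h y ^ 2 := by
    rw [← integral_const_mul, ← integral_const_mul,
      ← integral_ball_add (by fun_prop) (by fun_prop)]
    refine integral_ball_mono (by fun_prop) (by fun_prop) fun y _ => ?_
    nlinarith [sq_nonneg (r * g y - h y)]
  have b2 : 2 * r * (∫ y in ball y₀ r, radialDeriv g y₀ y * h y)
      ≤ r ^ 2 * (∫ y in ball y₀ r, normSqGrad g y) + r ^ 2 * ∫ y in ball y₀ r, h y ^ 2 := by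
    rw [← integral_const_mul, ← integral_const_mul, ← integral_const_mul,
      ← integral_ball_add (by fun_prop) (by fun_prop)]
    refine integral_ball_mono (by fun_prop) (by fun_prop) fun y hy => ?_
    rw [mem_ball, dist_eq_norm] at hy
    have i1 := radialDeriv_sq_le g y₀ y
    have i2 : ‖y - y₀‖ ^ 2 * normSqGrad g y ≤ r ^ 2 * normSqGrad g y :=
      mul_le_mul_of_nonneg_right (pow_le_pow_left₀ (norm_nonneg _) hy.le 2) (normSqGrad_nonneg g y)
    nlinarith [sq_nonneg (radialDeriv g y₀ y - r * h y)]
  have b3 : -height g h y₀ r ≤ 2 * sphereIntegral (fun y => g y * h y) y₀ r := by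
    rw [height, neg_eq_neg_one_mul, ← sphereIntegral_const_mul, ← sphereIntegral_const_mul]
    refine sphereIntegral_mono (by fun_prop) (by fun_prop) hr.le fun y => ?_
    nlinarith [sq_nonneg (g y + h y)]
  have p1 : 0 ≤ ∫ y in ball y₀ r, g y ^ 2 := integral_nonneg fun y => sq_nonneg _
  have p2 : 0 ≤ ∫ y in ball y₀ r, normSqGrad g y := integral_nonneg fun y => normSqGrad_nonneg g y
  have hl := P.one_lt
  have hn' : (1 : ℝ) ≤ n := by exact_mod_cast hn
  set A := ∫ y in ball y₀ r, g y ^ 2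
  set B := ∫ y in ball y₀ r, h y ^ 2
  set G := ∫ y in ball y₀ r, normSqGrad g y
  set S := ∫ y in ball y₀ r, g y * h y
  set T := ∫ y in ball y₀ r, radialDeriv g y₀ y * h y
  set Y := sphereIntegral (fun y => g y * h y) y₀ r
  set X := energy lam g h y₀ r
  set Z := height g h y₀ r
  have hX : 0 ≤ X := by
    by_contra hc
    nlinarith
  have hB : B ≤ r ^ 2 * X := by nlinarith
  have hB' : B ≤ X := by nlinarith [mul_le_of_le_one_left hX (pow_le_one₀ hr.le hr1 (n := 2))]
  have hS : S ≤ r * ((9 / 8) * X) := by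
    have : 2 * r * S ≤ 2 * r * (r * ((9 / 8) * X)) := by
      nlinarith [mul_le_mul_of_nonneg_left (show A ≤ 5 / 4 * X by linarith) (sq_nonneg r)]
    exact le_of_mul_le_mul_left this (by positivity)
  have hT : 2 * T ≤ r * ((9 / 4) * X) := by
    have : r * (2 * T) ≤ r * (r * ((9 / 4) * X)) := by
      nlinarith [mul_le_mul_of_nonneg_left (show G + B ≤ 9 / 4 * X by linarith) (sq_nonneg r)]
    exact le_of_mul_le_mul_left this hr
  have hY : -(r * X) ≤ 2 * (r * Y) := by
    have : r * Z ≤ 1 * Z := mul_le_mul_of_nonneg_right hr1 hH0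
    nlinarith
  have hA : 0 ≤ 4 * lam * A := by positivity
  have hS' : (n - 1) * S ≤ (n - 1) * (r * ((9 / 8) * X)) :=
    mul_le_mul_of_nonneg_left hS (by linarith)
  have hrX : 0 ≤ r * X := by positivity
  -- The terms add up to the constant `9/8 * (n - 1) + 9/4 + 1/2`, which is at most `2 * n + 2`.
  nlinarith [mul_le_mul_of_nonneg_right hn' hrX]

/-- Almost monotonicity of the frequency where it is at least `1`. -/
lemma hasDerivAt_log_frequency (P : IsCoupledPair lam y₀ R g h) (hn : 1 ≤ n) {r : ℝ} (hr : 0 < r)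
    (hr1 : r ≤ 1) (hrR : r ≤ R) (hN : 1 ≤ frequency lam g h y₀ r) :
    ∃ d : ℝ, -(2 * n + 2) ≤ d ∧
      HasDerivAt (fun ρ => Real.log (frequency lam g h y₀ ρ)) d r := by
  have hHne : height g h y₀ r ≠ 0 := by
    intro h0
    rw [frequency, h0, div_zero, mul_zero] at hN
    linarith
  have hHpos : 0 < height g h y₀ r := lt_of_le_of_ne (height_nonneg g h y₀ hr.le) hHne.symm
  have hH : height g h y₀ r ≤ r * energy lam g h y₀ r := by
    rwa [frequency, ← mul_div_assoc, le_div_iff₀ hHpos, one_mul] at hN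
  have hE : 0 < energy lam g h y₀ r := by
    by_contra hc
    nlinarith
  have hd := ((hasDerivAt_id r).mul
    ((P.hasDerivAt_energy hr).div (P.hasDerivAt_height hr hrR) hHne)).log
      (show (frequency lam g h y₀ r) ≠ 0 by linarith)
  refine ⟨_, ?_, hd⟩
  have k1 := P.sq_mul_sphereIntegral_energyDensity hr hrR
  have k2 := P.remainder_lower_bound hn hr hr1 hrR hH
  have k3 := P.sq_mul_energy_le hr hrR
  simp only [id, Pi.mul_apply, Pi.div_apply]
  set X := energy lam g h y₀ r
  set Z := height g h y₀ r
  set Q := sphereIntegral (energyDensity lam g h) y₀ r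
  set W := sphereIntegral (fun y => radialDeriv g y₀ y ^ 2 + radialDeriv h y₀ y ^ 2) y₀ r
  set M := 4 * lam * (∫ y in ball y₀ r, g y ^ 2) - (n - 1) * (∫ y in ball y₀ r, g y * h y)
          - 2 * (∫ y in ball y₀ r, radialDeriv g y₀ y * h y)
          + r * sphereIntegral (fun y => g y * h y) y₀ r
  -- The dimensional terms `1 / r + (n - 1) / r - n / r` cancel; the first summand that remains is
  -- nonnegative by Cauchy-Schwarz, the second is the remainder.
  have e : (1 * (X / Z) + r * ((Q * Z - X * (n * Z / r + 2 * X)) / Z ^ 2)) / (r * (X / Z))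
      = 2 * (Z * W - (r * X) ^ 2) / (r ^ 2 * X * Z) + M / (r * X) := by
    field_simp
    linear_combination Z * k1
  rw [e]
  have f1 : 0 ≤ 2 * (Z * W - (r * X) ^ 2) / (r ^ 2 * X * Z) :=
    div_nonneg (by linarith) (by positivity)
  have f2 : -(2 * (n : ℝ) + 2) ≤ M / (r * X) := by
    rw [le_div_iff₀ (by positivity)]
    linarith
  linarith

end IsCoupledPair

/-! ### Comparison of frequencies at two radii -/

namespace IsCoupledPair

variable {n : ℕ} {lam : ℝ} {y₀ : E (n + 1)} {R : ℝ} {g h : E (n + 1) → ℝ}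

lemma continuousAt_frequency (P : IsCoupledPair lam y₀ R g h) {r : ℝ} (hr : 0 < r) (hrR : r ≤ R)
    (h0 : height g h y₀ r ≠ 0) : ContinuousAt (frequency lam g h y₀) r :=
  continuousAt_id.mul ((P.hasDerivAt_energy hr).continuousAt.div
    (P.hasDerivAt_height hr hrR).continuousAt h0)

lemma frequency_le_exp_mul (P : IsCoupledPair lam y₀ R g h) (hn : 1 ≤ n) {a b : ℝ} (ha : 0 < a)
    (hab : a ≤ b) (hb : b ≤ 1) (hbR : b ≤ R)
    (hN : ∀ r ∈ Icc a b, 1 ≤ frequency lam g h y₀ r) :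
    frequency lam g h y₀ a ≤ Real.exp (2 * n + 2) * frequency lam g h y₀ b := by
  have hd : ∀ r ∈ Icc a b, ∃ d : ℝ, -(2 * n + 2) ≤ d ∧
      HasDerivAt (fun ρ => Real.log (frequency lam g h y₀ ρ)) d r := fun r hr =>
    P.hasDerivAt_log_frequency hn (ha.trans_le hr.1) (hr.2.trans hb) (hr.2.trans hbR) (hN r hr)
  have hd' : ∀ r ∈ Icc a b, ∃ d : ℝ, 0 ≤ d ∧ HasDerivAt
      (fun ρ => Real.log (frequency lam g h y₀ ρ) + (2 * n + 2) * ρ) d r := by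
    intro r hr
    obtain ⟨d, hd1, hd2⟩ := hd r hr
    exact ⟨_, by linarith, hd2.add ((hasDerivAt_id r).const_mul (2 * (n : ℝ) + 2))⟩
  have hmono : MonotoneOn (fun ρ => Real.log (frequency lam g h y₀ ρ) + (2 * n + 2) * ρ)
      (Icc a b) := by
    refine monotoneOn_of_deriv_nonneg (convex_Icc a b) ?_ ?_ ?_
    · intro r hr
      obtain ⟨d, -, hd2⟩ := hd' r hr
      exact hd2.continuousAt.continuousWithinAt
    · intro r hr
      obtain ⟨d, -, hd2⟩ := hd' r (interior_subset hr)
      exact hd2.differentiableAt.differentiableWithinAt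
    · intro r hr
      obtain ⟨d, hd1, hd2⟩ := hd' r (interior_subset hr)
      rwa [hd2.deriv]
  have h1 := hmono (left_mem_Icc.2 hab) (right_mem_Icc.2 hab) hab
  have pa : 0 < frequency lam g h y₀ a := by linarith [hN a (left_mem_Icc.2 hab)]
  have pb : 0 < frequency lam g h y₀ b := by linarith [hN b (right_mem_Icc.2 hab)]
  rw [← Real.log_le_log_iff pa (by positivity), Real.log_mul (Real.exp_ne_zero _) pb.ne',
    Real.log_exp]
  have : (2 * (n : ℝ) + 2) * (b - a) ≤ (2 * n + 2) * 1 := by gcongr; linarith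
  simp only at h1
  linarith

lemma height_ne_zero_of_le (P : IsCoupledPair lam y₀ R g h) {s r : ℝ} (hs : 0 < s) (hsr : s ≤ r)
    (hrR : r ≤ R) (h0 : height g h y₀ s ≠ 0) : height g h y₀ r ≠ 0 := by
  rcases hsr.eq_or_lt with rfl | hlt
  · exact h0
  · exact fun h => h0 (P.height_eq_zero_of_lt hs hlt hrR h)

lemma height_ne_zero_of_frequency {r : ℝ} (hN : 1 < frequency lam g h y₀ r) :
    height g h y₀ r ≠ 0 := by
  intro h0
  rw [frequency, h0, div_zero, mul_zero] at hN
  linarith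

lemma frequency_le_exp_mul_max (P : IsCoupledPair lam y₀ R g h) (hn : 1 ≤ n) {a b : ℝ}
    (ha : 0 < a) (hab : a ≤ b) (hb : b ≤ 1) (hbR : b ≤ R) :
    frequency lam g h y₀ a ≤ Real.exp (2 * n + 2) * max 1 (frequency lam g h y₀ b) := by
  have hexp : 1 ≤ Real.exp (2 * n + 2) := Real.one_le_exp (by positivity)
  rcases le_or_gt (frequency lam g h y₀ a) 1 with hNa | hNa
  · exact hNa.trans (one_le_mul_of_one_le_of_one_le hexp (le_max_left _ _))
  have hcont : ContinuousOn (frequency lam g h y₀) (Icc a b) := fun r hr =>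
    (P.continuousAt_frequency (ha.trans_le hr.1) (hr.2.trans hbR)
      (P.height_ne_zero_of_le ha hr.1 (hr.2.trans hbR)
        (height_ne_zero_of_frequency hNa))).continuousWithinAt
  set S : Set ℝ := Icc a b ∩ frequency lam g h y₀ ⁻¹' Iic 1 with hS
  rcases S.eq_empty_or_nonempty with hemp | hne
  · have hN : ∀ r ∈ Icc a b, 1 ≤ frequency lam g h y₀ r := by
      intro r hr
      by_contra hc
      have : r ∈ S := ⟨hr, (not_le.1 hc).le⟩
      simp [hemp] at this
    refine (P.frequency_le_exp_mul hn ha hab hb hbR hN).trans ?_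
    gcongr
    exact le_max_right _ _
  · have hcomp : IsCompact S := isCompact_Icc.of_isClosed_subset
      (hcont.preimage_isClosed_of_isClosed isClosed_Icc isClosed_Iic) inter_subset_left
    -- The first radius at which the frequency falls to `1`.
    obtain ⟨c, ⟨⟨hac, hcb⟩, hc1⟩, hleast⟩ := hcomp.exists_isLeast hne
    obtain ⟨d, hd, hd1⟩ := intermediate_value_Icc' hac
      (hcont.mono (Icc_subset_Icc_right hcb)) ⟨hc1, hNa.le⟩
    have hcd : c = d := le_antisymm (hleast ⟨⟨hd.1, hd.2.trans hcb⟩, hd1.le⟩) hd.2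
    have hN : ∀ r ∈ Icc a c, 1 ≤ frequency lam g h y₀ r := by
      intro r hr
      by_contra hcon
      have hle := hleast (⟨⟨hr.1, hr.2.trans hcb⟩, (not_le.1 hcon).le⟩ : r ∈ S)
      rw [le_antisymm hr.2 hle, hcd, hd1] at hcon
      exact hcon le_rfl
    refine (P.frequency_le_exp_mul hn ha hac (hcb.trans hb) (hcb.trans hbR) hN).trans ?_
    gcongr
    exact (mem_Iic.1 hc1).trans (le_max_left _ _)

lemma exp_neg_mul_frequency_le (P : IsCoupledPair lam y₀ R g h) (hn : 1 ≤ n) {a b : ℝ}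
    (ha : 0 < a) (hab : a < b) (hb : b ≤ 1) (hbR : b ≤ R)
    (hN : ∀ r ∈ Ioo a b, 1 < frequency lam g h y₀ r) :
    Real.exp (-(2 * n + 2)) * frequency lam g h y₀ a ≤ frequency lam g h y₀ b := by
  have hmid : (a + b) / 2 ∈ Ioo a b := ⟨by linarith, by linarith⟩
  have hHb : height g h y₀ b ≠ 0 := P.height_ne_zero_of_le (ha.trans hmid.1) hmid.2.le hbR
    (height_ne_zero_of_frequency (hN _ hmid))
  have hNb : 1 ≤ frequency lam g h y₀ b :=
    ge_of_tendsto ((P.continuousAt_frequency (ha.trans hab) hbR hHb).tendsto.mono_left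
      (nhdsWithin_le_nhds (s := Iio b)))
      (Filter.eventually_of_mem (Ioo_mem_nhdsLT hab) fun r hr => (hN r hr).le)
  by_cases hHa : height g h y₀ a = 0
  · have : frequency lam g h y₀ a = 0 := by rw [frequency, hHa, div_zero, mul_zero]
    rw [this, mul_zero]
    linarith
  · have hNa : 1 ≤ frequency lam g h y₀ a :=
      ge_of_tendsto ((P.continuousAt_frequency ha (hab.le.trans hbR) hHa).tendsto.mono_left
        (nhdsWithin_le_nhds (s := Ioi a)))
        (Filter.eventually_of_mem (Ioo_mem_nhdsGT hab) fun r hr => (hN r hr).le)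
    have hall : ∀ r ∈ Icc a b, 1 ≤ frequency lam g h y₀ r := by
      intro r hr
      rcases hr.1.eq_or_lt with rfl | h1
      · exact hNa
      rcases hr.2.eq_or_lt with rfl | h2
      · exact hNb
      exact (hN r ⟨h1, h2⟩).le
    have := P.frequency_le_exp_mul hn ha hab.le hb hbR hall
    rw [Real.exp_neg, inv_mul_le_iff₀ (Real.exp_pos _)]
    exact this

end IsCoupledPair

/-! ### The lifted eigenfunction as a coupled pair -/

lemma partialDeriv_congr {m : ℕ} {f g : E m → ℝ} {y : E m} (h : f =ᶠ[nhds y] g) (i : Fin m) :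
    partialDeriv i f y = partialDeriv i g y := by
  rw [partialDeriv, h.fderiv_eq, partialDeriv]

lemma coordLaplacian_congr {m : ℕ} {f g : E m → ℝ} {y : E m} (h : f =ᶠ[nhds y] g) :
    coordLaplacian f y = coordLaplacian g y :=
  Finset.sum_congr rfl fun i _ => partialDeriv_congr
    (h.eventuallyEq_nhds.mono fun _ hz => partialDeriv_congr hz i) i

lemma coordLaplacian_eq_laplacian {m : ℕ} {f : E m → ℝ} {y : E m} (hf : ContDiffAt ℝ 2 f y) :
    coordLaplacian f y = Laplacian.laplacian f y := by
  have hd : DifferentiableAt ℝ (fderiv ℝ f) y :=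
    (hf.fderiv_right (m := 1) (by norm_num)).differentiableAt one_ne_zero
  rw [laplacian_eq_iteratedFDeriv_orthonormalBasis f (EuclideanSpace.basisFun (Fin m) ℝ)]
  refine Finset.sum_congr rfl fun i _ => ?_
  unfold partialDeriv
  rw [fderiv_clm_apply hd (by fun_prop), iteratedFDeriv_two_apply]
  simp

lemma norm_gradient_sq {m : ℕ} (f : E m → ℝ) (y : E m) :
    ‖gradient f y‖ ^ 2 = normSqGrad f y := by
  rw [EuclideanSpace.norm_sq_eq]
  refine Finset.sum_congr rfl fun i _ => ?_
  have : partialDeriv i f y = (gradient f y) i := by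
    rw [partialDeriv, ← toDual_gradient, toDual_apply_apply,
      EuclideanSpace.inner_single_right, one_mul]
    rfl
  rw [this, Real.norm_eq_abs, sq_abs]

lemma contDiffOn_partialDeriv {m : ℕ} {k l : WithTop ℕ∞} {f : E m → ℝ} {s : Set (E m)}
    (hs : IsOpen s) (hf : ContDiffOn ℝ k f s) (hl : l + 1 ≤ k) (i : Fin m) :
    ContDiffOn ℝ l (partialDeriv i f) s :=
  (hf.fderiv_of_isOpen hs hl).clm_apply contDiffOn_const

/-- The projection `(x, x_{n+1}) ↦ x` as a continuous linear map. -/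
noncomputable def projL (n : ℕ) : E (n + 1) →L[ℝ] E n :=
  LinearMap.toContinuousLinearMap
    { toFun := proj
      map_add' := fun _ _ => rfl
      map_smul' := fun _ _ => rfl }

@[simp] lemma projL_apply {n : ℕ} (y : E (n + 1)) : projL n y = proj y := rfl

lemma proj_single_castSucc {n : ℕ} (i : Fin n) :
    proj (EuclideanSpace.single i.castSucc (1 : ℝ)) = EuclideanSpace.single i (1 : ℝ) := by
  ext j
  simp [proj, PiLp.single_apply]

lemma proj_single_last {n : ℕ} :
    proj (EuclideanSpace.single (Fin.last n) (1 : ℝ)) = (0 : E n) := by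
  ext j
  simp [proj]

lemma isOpen_cylinder {n : ℕ} {Ω : Set (E n)} (hΩ : IsOpen Ω) : IsOpen (cylinder Ω) :=
  hΩ.preimage (projL n).continuous

lemma contDiffOn_lift {n : ℕ} {k : WithTop ℕ∞} (lam : ℝ) {w : E n → ℝ} {Ω : Set (E n)}
    (hw : ContDiffOn ℝ k w Ω) : ContDiffOn ℝ k (lift lam w) (cylinder Ω) := by
  have h1 : ContDiffOn ℝ k (fun y : E (n + 1) => w (projL n y)) (cylinder Ω) :=
    hw.comp (projL n).contDiff.contDiffOn fun y hy => hy
  have h2 : ContDiff ℝ k fun y : E (n + 1) => Real.exp (Real.sqrt lam * y (Fin.last n)) :=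
    (contDiff_const.mul (EuclideanSpace.proj (Fin.last n) : E (n + 1) →L[ℝ] ℝ).contDiff).exp
  exact h1.mul h2.contDiffOn

lemma hasFDerivAt_lift {n : ℕ} (lam : ℝ) {w : E n → ℝ} {y : E (n + 1)}
    (hw : DifferentiableAt ℝ w (proj y)) :
    HasFDerivAt (lift lam w) (w (proj y) • Real.exp (Real.sqrt lam * y (Fin.last n)) •
        Real.sqrt lam • (EuclideanSpace.proj (Fin.last n) : E (n + 1) →L[ℝ] ℝ)
      + Real.exp (Real.sqrt lam * y (Fin.last n)) • (fderiv ℝ w (proj y)).comp (projL n)) y := by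
  have h1 : HasFDerivAt (fun y : E (n + 1) => w (projL n y))
      ((fderiv ℝ w (proj y)).comp (projL n)) y :=
    HasFDerivAt.comp y (f := projL n) hw.hasFDerivAt (projL n).hasFDerivAt
  have h2 : HasFDerivAt (fun y : E (n + 1) => Real.exp (Real.sqrt lam * y (Fin.last n)))
      (Real.exp (Real.sqrt lam * y (Fin.last n)) •
        Real.sqrt lam • (EuclideanSpace.proj (Fin.last n) : E (n + 1) →L[ℝ] ℝ)) y :=
    ((EuclideanSpace.proj (Fin.last n) : E (n + 1) →L[ℝ] ℝ).hasFDerivAt.const_mul _).exp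
  exact h1.mul h2

lemma partialDeriv_castSucc_lift {n : ℕ} (lam : ℝ) {w : E n → ℝ} {y : E (n + 1)}
    (hw : DifferentiableAt ℝ w (proj y)) (i : Fin n) :
    partialDeriv i.castSucc (lift lam w) y = lift lam (partialDeriv i w) y := by
  rw [partialDeriv, (hasFDerivAt_lift lam hw).fderiv]
  simp [proj_single_castSucc, lift, partialDeriv,
    (Fin.castSucc_lt_last i).ne', mul_comm]

lemma partialDeriv_last_lift {n : ℕ} (lam : ℝ) {w : E n → ℝ} {y : E (n + 1)}
    (hw : DifferentiableAt ℝ w (proj y)) :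
    partialDeriv (Fin.last n) (lift lam w) y = Real.sqrt lam * lift lam w y := by
  rw [partialDeriv, (hasFDerivAt_lift lam hw).fderiv]
  simp [proj_single_last, lift]
  ring

lemma coordLaplacian_lift {n : ℕ} {lam : ℝ} (hlam : 0 ≤ lam) {w : E n → ℝ} {Ω : Set (E n)}
    (hΩ : IsOpen Ω) (hw : ContDiffOn ℝ 2 w Ω) {y : E (n + 1)} (hy : y ∈ cylinder Ω) :
    coordLaplacian (lift lam w) y
      = lift lam (fun x => coordLaplacian w x + lam * w x) y := by
  have hnhds : cylinder Ω ∈ nhds y := (isOpen_cylinder hΩ).mem_nhds hy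
  have hd : ∀ z ∈ cylinder Ω, DifferentiableAt ℝ w (proj z) := fun z hz =>
    (hw.contDiffAt (hΩ.mem_nhds hz)).differentiableAt two_ne_zero
  have hd' : ∀ i, DifferentiableAt ℝ (partialDeriv i w) (proj y) := fun i =>
    ((contDiffOn_partialDeriv (l := 1) hΩ hw (by norm_num) i).contDiffAt
      (hΩ.mem_nhds hy)).differentiableAt one_ne_zero
  have h1 : ∀ i : Fin n, partialDeriv i.castSucc (partialDeriv i.castSucc (lift lam w)) y
      = lift lam (partialDeriv i (partialDeriv i w)) y := by
    intro i
    rw [← partialDeriv_castSucc_lift lam (hd' i) i]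
    exact partialDeriv_congr (Filter.eventually_of_mem hnhds
      fun z hz => partialDeriv_castSucc_lift lam (hd z hz) i) _
  have h2 : partialDeriv (Fin.last n) (partialDeriv (Fin.last n) (lift lam w)) y
      = lam * lift lam w y := by
    rw [partialDeriv_congr (g := fun z => Real.sqrt lam * lift lam w z)
      (Filter.eventually_of_mem hnhds fun z hz => partialDeriv_last_lift lam (hd z hz))]
    have h3 : partialDeriv (Fin.last n) (fun z => Real.sqrt lam * lift lam w z) y
        = Real.sqrt lam * partialDeriv (Fin.last n) (lift lam w) y := by
      simp [partialDeriv, fderiv_const_mul (hasFDerivAt_lift lam (hd y hy)).differentiableAt]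
    rw [h3, partialDeriv_last_lift lam (hd y hy), ← mul_assoc, Real.mul_self_sqrt hlam]
  rw [coordLaplacian, Fin.sum_univ_castSucc, h2]
  simp only [h1, lift, coordLaplacian, add_mul, Finset.sum_mul]
  ring

lemma contDiff_bump_mul {m : ℕ} {k : ℕ} {f : E m → ℝ} {U : Set (E m)} (hU : IsOpen U)
    (hf : ContDiffOn ℝ k f U) {y₀ : E m} (χ : ContDiffBump y₀) (hχ : closedBall y₀ χ.rOut ⊆ U) :
    ContDiff ℝ k fun y => χ y * f y := by
  rw [contDiff_iff_contDiffAt]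
  intro y
  by_cases hy : y ∈ U
  · exact χ.contDiff.contDiffAt.mul (hf.contDiffAt (hU.mem_nhds hy))
  · have hy' : y ∉ tsupport χ := by
      rw [χ.tsupport_eq]
      exact fun h => hy (hχ h)
    refine (contDiffAt_const (c := (0 : ℝ))).congr_of_eventuallyEq ?_
    filter_upwards [notMem_tsupport_iff_eventuallyEq.1 hy'] with z hz
    simp [hz]

lemma bump_mul_eventuallyEq {m : ℕ} (f : E m → ℝ) {y₀ : E m} (χ : ContDiffBump y₀) {y : E m}
    (hy : y ∈ ball y₀ χ.rIn) : (fun y => χ y * f y) =ᶠ[nhds y] f := by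
  filter_upwards [isOpen_ball.mem_nhds hy] with z hz
  rw [χ.one_of_mem_closedBall (ball_subset_closedBall hz), one_mul]

namespace IsEigenfunction

variable {n : ℕ} {lam : ℝ} {Ω : Set (E n)} {u : E n → ℝ}

lemma contDiffOn_laplacian (hu : IsEigenfunction lam Ω u) :
    ContDiffOn ℝ 2 (Laplacian.laplacian u) Ω := by
  have h1 : ContDiffOn ℝ 2 (coordLaplacian u) Ω :=
    ContDiffOn.sum fun i _ => contDiffOn_partialDeriv hu.isOpen
      (contDiffOn_partialDeriv (l := 3) hu.isOpen hu.contDiffOn (by norm_num) i) (by norm_num) i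
  refine h1.congr fun x hx => ?_
  exact (coordLaplacian_eq_laplacian
    ((hu.contDiffOn.contDiffAt (hu.isOpen.mem_nhds hx)).of_le (by norm_num))).symm

lemma contDiffOn_vFun (hu : IsEigenfunction lam Ω u) : ContDiffOn ℝ 2 (vFun lam u) Ω :=
  hu.contDiffOn_laplacian.sub (contDiffOn_const.mul (hu.contDiffOn.of_le (by norm_num)))

lemma coordLaplacian_gFun (hu : IsEigenfunction lam Ω u) (hlam : 0 ≤ lam) {y : E (n + 1)}
    (hy : y ∈ cylinder Ω) :
    coordLaplacian (gFun lam u) y = 2 * lam * gFun lam u y + hFun lam u y := by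
  have hu2 : ContDiffOn ℝ 2 u Ω := hu.contDiffOn.of_le (by norm_num)
  rw [gFun, coordLaplacian_lift hlam hu.isOpen hu2 hy, hFun]
  simp only [lift, vFun,
    coordLaplacian_eq_laplacian (hu2.contDiffAt (hu.isOpen.mem_nhds (show proj y ∈ Ω from hy)))]
  ring

lemma coordLaplacian_hFun (hu : IsEigenfunction lam Ω u) (hlam : 0 ≤ lam) {y : E (n + 1)}
    (hy : y ∈ cylinder Ω) : coordLaplacian (hFun lam u) y = 0 := by
  have hx : proj y ∈ Ω := hy
  have hmem := hu.isOpen.mem_nhds hx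
  have hu2 : ContDiffAt ℝ 2 u (proj y) := (hu.contDiffOn.contDiffAt hmem).of_le (by norm_num)
  have hv : vFun lam u = Laplacian.laplacian u - lam • u := rfl
  rw [hFun, coordLaplacian_lift hlam hu.isOpen hu.contDiffOn_vFun hy]
  simp only [lift, coordLaplacian_eq_laplacian (hu.contDiffOn_vFun.contDiffAt hmem)]
  rw [hv, (hu.contDiffOn_laplacian.contDiffAt hmem).laplacian_sub
      (show ContDiffAt ℝ 2 (lam • u) (proj y) from hu2.const_smul lam),
    laplacian_smul lam hu2, hu.equation _ hx]
  simp only [Pi.sub_apply, Pi.smul_apply, smul_eq_mul]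
  ring

/-- Near a closed ball in the cylinder, the frequency of `u` is that of a globally defined coupled
pair, obtained by multiplying `g` and `h` by a bump function. -/
lemma exists_isCoupledPair (hu : IsEigenfunction lam Ω u) (hlam : 1 < lam) {y₀ : E (n + 1)} {r : ℝ}
    (hr : 0 < r) (hball : closedBall y₀ r ⊆ cylinder Ω) :
    ∃ R g h, r < R ∧ IsCoupledPair lam y₀ R g h ∧
      ∀ s, 0 ≤ s → s < R → N lam u y₀ s = frequency lam g h y₀ s := by
  have hopen := isOpen_cylinder hu.isOpen
  obtain ⟨δ, hδ, hsub⟩ := (isCompact_closedBall y₀ r).exists_cthickening_subset_open hopen hball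
  rw [cthickening_closedBall hδ.le hr.le] at hsub
  let χ : ContDiffBump y₀ := ⟨r + δ / 2, δ + r, by positivity, by linarith⟩
  have eg : ∀ y ∈ ball y₀ (r + δ / 2), (fun y => χ y * gFun lam u y) =ᶠ[nhds y] gFun lam u :=
    fun y hy => bump_mul_eventuallyEq _ χ hy
  have eh : ∀ y ∈ ball y₀ (r + δ / 2), (fun y => χ y * hFun lam u y) =ᶠ[nhds y] hFun lam u :=
    fun y hy => bump_mul_eventuallyEq _ χ hy
  have hcyl : ball y₀ (r + δ / 2) ⊆ cylinder Ω :=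
    ((ball_subset_ball (by linarith)).trans ball_subset_closedBall).trans hsub
  refine ⟨r + δ / 2, fun y => χ y * gFun lam u y, fun y => χ y * hFun lam u y, by linarith,
    ⟨hlam, ?_, ?_, ?_, ?_⟩, ?_⟩
  · exact contDiff_bump_mul (k := 2) hopen
      (contDiffOn_lift lam (hu.contDiffOn.of_le (by norm_num))) χ hsub
  · exact contDiff_bump_mul (k := 2) hopen (contDiffOn_lift lam hu.contDiffOn_vFun) χ hsub
  · intro y hy
    rw [coordLaplacian_congr (eg y hy), hu.coordLaplacian_gFun (by linarith) (hcyl hy),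
      (eg y hy).eq_of_nhds, (eh y hy).eq_of_nhds]
  · intro y hy
    rw [coordLaplacian_congr (eh y hy), hu.coordLaplacian_hFun (by linarith) (hcyl hy)]
  · intro s hs hsR
    have hD : D lam u y₀ s
        = energy lam (fun y => χ y * gFun lam u y) (fun y => χ y * hFun lam u y) y₀ s := by
      refine setIntegral_congr_fun measurableSet_ball fun y hy => ?_
      have hy' := ball_subset_ball hsR.le hy
      have n1 : normSqGrad (fun y => χ y * gFun lam u y) y = normSqGrad (gFun lam u) y :=
        Finset.sum_congr rfl fun i _ => by rw [partialDeriv_congr (eg y hy')]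
      have n2 : normSqGrad (fun y => χ y * hFun lam u y) y = normSqGrad (hFun lam u) y :=
        Finset.sum_congr rfl fun i _ => by rw [partialDeriv_congr (eh y hy')]
      have v1 := (eg y hy').eq_of_nhds
      have v2 := (eh y hy').eq_of_nhds
      simp only [energyDensity, n1, n2, v1, v2, norm_gradient_sq]
    have hH : H lam u y₀ s
        = height (fun y => χ y * gFun lam u y) (fun y => χ y * hFun lam u y) y₀ s := by
      refine sphereIntegral_congr hs fun y hy => ?_
      have hy' : y ∈ ball y₀ (r + δ / 2) := by
        rw [mem_ball, dist_eq_norm, hy]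
        exact hsR
      have v1 := (eg y hy').eq_of_nhds
      have v2 := (eh y hy').eq_of_nhds
      simp only [v1, v2]
    rw [N, frequency, hD, hH]

end IsEigenfunction

lemma monotonicityFormula_one {n : ℕ} (hn : 1 ≤ n) : MonotonicityFormula n 1 (2 * n + 2) := by
  intro lam hlam Ω u hu y₀ r hr hr1 hball hN
  obtain ⟨R, g, h, hrR, P, hNeq⟩ := hu.exists_isCoupledPair hlam hr hball
  rw [hNeq r hr.le hrR] at hN
  obtain ⟨d, hd1, hd2⟩ := P.hasDerivAt_log_frequency hn hr hr1 hrR.le hN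
  have hd3 : HasDerivAt (fun ρ => Real.log (N lam u y₀ ρ)) d r := by
    refine hd2.congr_of_eventuallyEq ?_
    filter_upwards [lt_mem_nhds hr, gt_mem_nhds hrR] with s hs1 hs2
    rw [hNeq s hs1.le hs2]
  exact ⟨hd3.differentiableAt, by rwa [hd3.deriv]⟩

end BiharmonicFrequency

theorem corollary2p4 (n : ℕ) (hn : 2 ≤ n) :
    ∃ C₀ : ℝ, 0 < C₀ ∧
      (∃ K : ℝ, 0 < K ∧ BiharmonicFrequency.MonotonicityFormula n C₀ K) ∧
      ∃ C : ℝ, 0 < C ∧ ∃ C' : ℝ, 0 < C' ∧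
        ∀ (lam : ℝ), 1 < lam →
        ∀ (Ω : Set (BiharmonicFrequency.E n)) (u : BiharmonicFrequency.E n → ℝ),
          BiharmonicFrequency.IsEigenfunction lam Ω u →
        ∀ (r₁ r₂ : ℝ), 0 < r₁ → r₁ < r₂ → r₂ ≤ 1 →
          Metric.closedBall (0 : BiharmonicFrequency.E (n + 1)) r₂
            ⊆ BiharmonicFrequency.cylinder Ω →
          BiharmonicFrequency.N lam u 0 r₁
              ≤ C * max C₀ (BiharmonicFrequency.N lam u 0 r₂) ∧
          ((∀ r ∈ Set.Ioo r₁ r₂, C₀ < BiharmonicFrequency.N lam u 0 r) →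
            C' * BiharmonicFrequency.N lam u 0 r₁ ≤ BiharmonicFrequency.N lam u 0 r₂) := by
  have hn1 : 1 ≤ n := one_le_two.trans hn
  refine ⟨1, one_pos, ⟨2 * n + 2, by positivity, BiharmonicFrequency.monotonicityFormula_one hn1⟩,
    Real.exp (2 * n + 2), Real.exp_pos _, Real.exp (-(2 * n + 2)), Real.exp_pos _, ?_⟩
  intro lam hlam Ω u hu r₁ r₂ h1 h12 h2 hball
  obtain ⟨R, g, h, hrR, P, hNeq⟩ := hu.exists_isCoupledPair hlam (h1.trans h12) hball
  rw [hNeq r₁ h1.le (h12.trans hrR), hNeq r₂ (h1.trans h12).le hrR]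
  refine ⟨P.frequency_le_exp_mul_max hn1 h1 h12.le h2 hrR.le, fun hN => ?_⟩
  refine P.exp_neg_mul_frequency_le hn1 h1 h12 h2 hrR.le fun r hr => ?_
  rw [← hNeq r (h1.trans hr.1).le (hr.2.trans hrR)]
  exact hN r hr
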